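/- All graphs are finite. A \emph{bigraph} $G$ is a graph with a designated bipartition $(V_1(G),V_2(G))$; isomorphisms of bigraphs map $V_i$ to $V_i$ for $i=1,2$, and a \emph{copy} of a bigraph $T$ in $G$ is an induced sub-bigraph of $G$ isomorphic to $T$. $G$ is \emph{balanced} if $|V_1(G)|=|V_2(G)|$. For $\epsilon>0$, $G$ is \emph{$\epsilon$-coherent} if every vertex in $V_1(G)$ has degree less than $\epsilon|V_2(G)|$, every vertex in $V_2(G)$ has degree less than $\epsilon|V_1(G)|$, and there are no $Z_1\subseteq V_1(G)$, $Z_2\subseteq V_2(G)$ with no edges between $Z_1$ and $Z_2$ and $|Z_i|\ge\epsilon|V_i(G)|$ for $i=1,2$. A \emph{parade} of length $(K,L)$ in $G$ is a sequence $\mathcal P=(A_1,\dots,A_K;B_1,\dots,B_L)$ of pairwise disjoint nonempty sets (\emph{blocks}) with $A_i\subseteq V_1(G)$, $B_j\subseteq V_2(G)$, all $A_i$ of the same cardinality $W_1$ and all $B_j$ of the same cardinality $W_2$; its \emph{width} is $(W_1,W_2)$. It is \emph{balanced} if $K=L$ and all blocks have the same cardinality. A \emph{contraction} of $\mathcal P$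 is a parade $(A'_1,\dots,A'_K;B'_1,\dots,B'_L)$ with $A'_i\subseteq A_i$ and $B'_j\subseteq B_j$ for all $i,j$. An induced sub-bigraph $H$ of $G$ is \emph{$\mathcal P$-rainbow} if every vertex of $H$ is in a block and no two are in the same block; its \emph{support} is $(\{i:V(H)\cap A_i\ne\emptyset\},\{j:V(H)\cap B_j\neq\emptyset\})$, and the indices of the blocks order $V_1(H)$ and $V_2(H)$ linearly. An \emph{ordered bigraph} $S$ is a bigraph with linear orders on $V_1(S)$ and on $V_2(S)$; its \emph{trace} relative to $\mathcal P$ is the set of supports of all $\mathcal P$-rainbow induced sub-bigraphs of $G$ that, with the above orders, are isomorphic to $S$ as ordered bigraphs. $\mathcal P$ is \emph{$\tau$-support-uniform} if for every ordered tree bigraph $S$ with at most $\tau$ vertices, the trace of $S$ is either empty or consists of all pairs $(I,J)$ with $I\subseteq\{1,\dots,K\}$, $J\subseteq\{1,\dots,L\}$, $|I|=|V_1(S)|$, $|J|=|V_2(S)|$. For $0<\kappa\le1$, $\mathcal P$ is \emph{$(\kappa,\tau)$-support-invariant} if for every contraction $\mathcal P'$ of $\mathcal P$ with $|A'_i|\ge\kappa|A_i|$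 and $|B'_j|\ge\kappa|B_j|$ for all $i,j$, every ordered tree bigraph with at most $\tau$ vertices has the same trace relative to $\mathcal P$ and to $\mathcal P'$. A set $X$ \emph{$\lambda$-covers} (respectively, \emph{$\lambda$-misses}) a set $Y$ if at least $\lambda|Y|$ vertices of $Y$ have a neighbour (respectively, no neighbour) in $X$. $\mathcal P$ is \emph{$\lambda$-concave} if there do not exist $Y\subseteq B_1\cup\dots\cup B_L$ and $1\le h_1<h_2<h_3\le K$ such that $Y$ $\lambda$-covers $A_{h_2}$ and $\lambda$-misses $A_{h_1}$ and $A_{h_3}$, and the same holds with the roles of the $A$'s and $B$'s exchanged. \textbf{Theorem.} Let $\delta\ge2$ and $\eta\ge0$ be integers. Let $T$ be a rooted tree bigraph such that every vertex has degree at most $\delta+1$, the root has degree at most $\delta$, and every path from the root to a leaf has length less than $\eta$. Let $\tau=\delta^{\eta+1}$ and let $0<\lambda\le2^{-30\delta}\delta^{-1-\eta}$. Let $G$ be a balanced bigraph with a balanced parade $\mathcal P$ of length $(K,K)$ and width $(W,W)$, where $K=(32\delta+4)\tau+2$, such that $\mathcal P$ is $\lambda$-concave, $(2^{-30\delta},\tau)$-support-invariant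 and $\tau$-support-uniform. If $G$ is $\epsilon$-coherent for some $\epsilon>0$ with $\epsilon\le2^{-30\delta}\,W/|V_1(G)|$, then there is a $\mathcal P$-rainbow copy of $T$ in $G$. -/

import Mathlib

/-- A (finite) bigraph: a graph with a designated ordered bipartition `(V₁, V₂)`. -/
structure Bigraph (V : Type*) where
  graph : SimpleGraph V
  V₁ : Finset V
  V₂ : Finset V
  cover : ∀ v, v ∈ V₁ ∨ v ∈ V₂
  disj : ∀ v, v ∈ V₁ → v ∉ V₂
  bipartite : ∀ u v, graph.Adj u v → (u ∈ V₁ ∧ v ∈ V₂) ∨ (u ∈ V₂ ∧ v ∈ V₁)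

namespace Bigraph

variable {V : Type*}

/-- The degree of a vertex (the vertex set of a bigraph is finite). -/
noncomputable def degree (G : Bigraph V) (v : V) : ℕ := (G.graph.neighborSet v).ncard

/-- A leaf is a vertex of degree one. -/
def IsLeaf (G : Bigraph V) (v : V) : Prop := G.degree v = 1

/-- A tree bigraph. -/
def IsTree (G : Bigraph V) : Prop := G.graph.IsTree

/-- A balanced bigraph: both sides have the same size. -/
def IsBalanced (G : Bigraph V) : Prop := G.V₁.card = G.V₂.card

/-- No vertex of `X` has a neighbour in `Y`. -/
def Anticomplete (G : Bigraph V) (X Y : Set V) : Prop :=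
  ∀ x ∈ X, ∀ y ∈ Y, ¬ G.graph.Adj x y

/-- `ε`-coherence (which includes `0 < ε`). -/
def IsCoherent (G : Bigraph V) (ε : ℝ) : Prop :=
  0 < ε ∧
  (∀ v ∈ G.V₁, (G.degree v : ℝ) < ε * G.V₂.card) ∧
  (∀ v ∈ G.V₂, (G.degree v : ℝ) < ε * G.V₁.card) ∧
  ¬ ∃ Z₁ Z₂ : Finset V, Z₁ ⊆ G.V₁ ∧ Z₂ ⊆ G.V₂ ∧
      ε * G.V₁.card ≤ (Z₁.card : ℝ) ∧ ε * G.V₂.card ≤ (Z₂.card : ℝ) ∧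
      G.Anticomplete (Z₁ : Set V) (Z₂ : Set V)

/-- `X` `lam`-covers `Y`: at least `lam * |Y|` vertices of `Y` have a neighbour in `X`. -/
def Covers (G : Bigraph V) (lam : ℝ) (X Y : Finset V) : Prop :=
  lam * Y.card ≤ ({y | y ∈ Y ∧ ∃ x ∈ X, G.graph.Adj x y} : Set V).ncard

/-- `X` `lam`-misses `Y`: at least `lam * |Y|` vertices of `Y` have no neighbour in `X`. -/
def Misses (G : Bigraph V) (lam : ℝ) (X Y : Finset V) : Prop :=
  lam * Y.card ≤ ({y | y ∈ Y ∧ ¬ ∃ x ∈ X, G.graph.Adj x y} : Set V).ncard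

/-- An isomorphism of the bigraph `T` with an induced sub-bigraph of `G`: an embedding of graphs
(preserving adjacency and non-adjacency) that maps each side into the corresponding side. The
induced sub-bigraph on its range is a copy of `T` in `G`, and every copy arises in this way. -/
structure Embedding {U : Type*} (T : Bigraph U) (G : Bigraph V) where
  toFun : T.graph ↪g G.graph
  map₁ : ∀ u ∈ T.V₁, toFun u ∈ G.V₁
  map₂ : ∀ u ∈ T.V₂, toFun u ∈ G.V₂

end Bigraph

/-- A bigraph with linear orders imposed on its two sides. -/
structure OrderedBigraph (V : Type*) extends Bigraph V where
  ord₁ : LinearOrder {v // v ∈ V₁}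
  ord₂ : LinearOrder {v // v ∈ V₂}

/-- A parade of length `(K, L)` in `G`. -/
structure Parade {V : Type*} (G : Bigraph V) (K L : ℕ) where
  A : Fin K → Finset V
  B : Fin L → Finset V
  A_nonempty : ∀ i, (A i).Nonempty
  B_nonempty : ∀ j, (B j).Nonempty
  A_subset : ∀ i, A i ⊆ G.V₁
  B_subset : ∀ j, B j ⊆ G.V₂
  A_disjoint : ∀ i i', i ≠ i' → Disjoint (A i) (A i')
  B_disjoint : ∀ j j', j ≠ j' → Disjoint (B j) (B j')
  A_card : ∀ i i', (A i).card = (A i').card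
  B_card : ∀ j j', (B j).card = (B j').card

namespace Parade

variable {V : Type*} {G : Bigraph V} {K L : ℕ}

/-- The width of the parade is `(W₁, W₂)`. -/
def HasWidth (P : Parade G K L) (W₁ W₂ : ℕ) : Prop :=
  (∀ i, (P.A i).card = W₁) ∧ (∀ j, (P.B j).card = W₂)

/-- A balanced parade: `K = L` and all blocks have the same cardinality. -/
def IsBalanced (P : Parade G K L) : Prop :=
  K = L ∧ ∀ i j, (P.A i).card = (P.B j).card

/-- `P'` is a contraction of `P`. -/
def IsContraction (P' P : Parade G K L) : Prop :=
  (∀ i, P'.A i ⊆ P.A i) ∧ (∀ j, P'.B j ⊆ P.B j)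

/-- The induced sub-bigraph on `X` is rainbow relative to `P`: every vertex of `X` is in a block,
and no two vertices of `X` are in the same block. -/
def IsRainbow (P : Parade G K L) (X : Set V) : Prop :=
  (∀ v ∈ X, (∃ i, v ∈ P.A i) ∨ (∃ j, v ∈ P.B j)) ∧
  (∀ u ∈ X, ∀ v ∈ X, ∀ i, u ∈ P.A i → v ∈ P.A i → u = v) ∧
  (∀ u ∈ X, ∀ v ∈ X, ∀ j, u ∈ P.B j → v ∈ P.B j → u = v)

/-- There is a `P`-rainbow copy of `T` in `G`. -/
def HasRainbowCopy {U : Type*} (P : Parade G K L) (T : Bigraph U) : Prop :=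
  ∃ f : T.Embedding G, P.IsRainbow (Set.range f.toFun)

/-- The support of a rainbow induced sub-bigraph with vertex set `X`. -/
def support (P : Parade G K L) (X : Set V) : Set (Fin K) × Set (Fin L) :=
  ({i | ∃ v ∈ X, v ∈ P.A i}, {j | ∃ v ∈ X, v ∈ P.B j})

/-- `f` exhibits a `P`-rainbow copy of the ordered bigraph `S`: the image of `f` is rainbow, and
`f` is order preserving from `S` to the `P`-ordering (by index of blocks) of its image. -/
def IsOrderedRainbowCopy {U : Type*} (P : Parade G K L) (S : OrderedBigraph U)
    (f : S.toBigraph.Embedding G) : Prop :=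
  P.IsRainbow (Set.range f.toFun) ∧
  (∀ u v : {x // x ∈ S.V₁}, S.ord₁.lt u v →
    ∀ i i', f.toFun u.1 ∈ P.A i → f.toFun v.1 ∈ P.A i' → i < i') ∧
  (∀ u v : {x // x ∈ S.V₂}, S.ord₂.lt u v →
    ∀ j j', f.toFun u.1 ∈ P.B j → f.toFun v.1 ∈ P.B j' → j < j')

/-- The trace of `S` relative to `P`: the set of supports of all `P`-rainbow copies of `S`. -/
def trace {U : Type*} (P : Parade G K L) (S : OrderedBigraph U) :
    Set (Set (Fin K) × Set (Fin L)) :=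
  {s | ∃ f : S.toBigraph.Embedding G,
    P.IsOrderedRainbowCopy S f ∧ s = P.support (Set.range f.toFun)}

/-- `τ`-support-uniformity. (Every finite ordered bigraph is isomorphic to one on a type in
`Type`, so all ordered tree bigraphs with at most `τ` vertices are covered.) -/
def IsSupportUniform (P : Parade G K L) (τ : ℕ) : Prop :=
  ∀ (U : Type) [Fintype U] (S : OrderedBigraph U), S.toBigraph.IsTree → Fintype.card U ≤ τ →
    P.trace S = ∅ ∨
    P.trace S = {s | s.1.ncard = S.V₁.card ∧ s.2.ncard = S.V₂.card}

/-- `(κ, τ)`-support-invariance. -/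
def IsSupportInvariant (P : Parade G K L) (κ : ℝ) (τ : ℕ) : Prop :=
  ∀ P' : Parade G K L, P'.IsContraction P →
    (∀ i, κ * (P.A i).card ≤ ((P'.A i).card : ℝ)) →
    (∀ j, κ * (P.B j).card ≤ ((P'.B j).card : ℝ)) →
    ∀ (U : Type) [Fintype U] (S : OrderedBigraph U), S.toBigraph.IsTree → Fintype.card U ≤ τ →
      P.trace S = P'.trace S

/-- `lam`-top-concavity. -/
def IsTopConcave (P : Parade G K L) (lam : ℝ) : Prop :=
  ∀ Y : Finset V, (∀ y ∈ Y, ∃ j, y ∈ P.B j) →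
    ¬ ∃ h₁ h₂ h₃ : Fin K, h₁ < h₂ ∧ h₂ < h₃ ∧
      G.Covers lam Y (P.A h₂) ∧ G.Misses lam Y (P.A h₁) ∧ G.Misses lam Y (P.A h₃)

/-- `lam`-bottom-concavity. -/
def IsBottomConcave (P : Parade G K L) (lam : ℝ) : Prop :=
  ∀ Y : Finset V, (∀ y ∈ Y, ∃ i, y ∈ P.A i) →
    ¬ ∃ h₁ h₂ h₃ : Fin L, h₁ < h₂ ∧ h₂ < h₃ ∧
      G.Covers lam Y (P.B h₂) ∧ G.Misses lam Y (P.B h₁) ∧ G.Misses lam Y (P.B h₃)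

/-- `lam`-concavity. -/
def IsConcave (P : Parade G K L) (lam : ℝ) : Prop :=
  P.IsTopConcave lam ∧ P.IsBottomConcave lam

end Parade

/-! Say that a connected part of `T` with a marked vertex in `V₁` is realized at the beginning (or
end) if some rainbow copy has the mark in the first (or last) of its blocks on that side. The claim
is that, for any mark, all of `T` is realized at one of the two ends. Suppose not. Then each end `e`
has a smallest unrealized part `D` with mark `r`. It is not a singleton, so `r` has a neighbour `x`
in `D`, and removing `x` leaves at most `δ + 1` branches, each realized at `e` with its neighbour of
`x` as mark. By support-uniformity and invariance (`Transfers`) a branch can be found in any blocks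
with the same order, even inside a small proportion of each block. As its mark is extreme, the mark
can be put in any of `4δ + 1` outer blocks at end `e`, which are kept free.

Candidates for `x`, the centres, are kept in both the first and the last of the blocks `B`. There
are four kinds, given by the end for the roots and the end for the centres. A round
(`Host.Round.exists_serves`) chooses one kind and attaches the next branch to a 1/32 proportion of
its centres; different centres may receive different copies. Neighbours of the new copies are
deleted from the inner blocks, so later branches have no edges to earlier ones. After `4δ + 1`
rounds some kind has used all its branches, and a surviving centre gives a realization of `D`, a
contradiction (`Attached.exists_realized`).

The heart is a single round. Copies are chosen greedily so that the root of a copy sees many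
untouched centres, the rest of the copy sees few, and all copies together cover little of each inner
block. Concavity supplies this: a set missing much of two blocks covers little of any block between
them. `card_le_of_concave` turns this into a degree statement: in an inner block, all but a quarter
of the block width have degree at most a small multiple (of order `lam`) of that of typical vertices
in the outer blocks, and `τ * lam ≤ κ` makes the sum over a copy negligible. For copy vertices in
`A` the comparison is with the typical degree `a` of roots to centres; for those in `B` it is with a
degree `d` of centres to reference roots. The minimal choice of `d` ties it to `a` (`light_le`), so
the damage on both sides stays proportional to the number of centres served. -/

open Finset

/-! ### Neighbourhoods, double counting, and degrees under concavity. -/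

section Neighbourhoods

variable {V : Type*} [Fintype V] (H : SimpleGraph V)

open Classical in
/-- The neighbours of `v` as a finset. -/
noncomputable def nb (v : V) : Finset V := univ.filter (H.Adj v)

/-- The vertices with a neighbour in `X`. -/
noncomputable def nbs [DecidableEq V] (X : Finset V) : Finset V := X.biUnion (nb H)

variable {H}

@[simp] theorem mem_nb {u v : V} : v ∈ nb H u ↔ H.Adj u v := by simp [nb]

variable [DecidableEq V]

theorem mem_nbs {X : Finset V} {v : V} : v ∈ nbs H X ↔ ∃ x ∈ X, H.Adj x v := by simp [nbs]

theorem nbs_union (X Y : Finset V) : nbs H (X ∪ Y) = nbs H X ∪ nbs H Y := by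
  ext v; simp only [mem_nbs, mem_union]; grind

theorem nbs_insert (X : Finset V) (w : V) : nbs H (insert w X) = nb H w ∪ nbs H X := by
  ext v; simp [mem_nbs]

theorem card_nbs_inter_le_sum (X Z : Finset V) :
    #(nbs H X ∩ Z) ≤ ∑ w ∈ X, #(nb H w ∩ Z) := by
  rw [nbs, biUnion_inter]; exact card_biUnion_le

theorem sum_card_nb_inter_comm (X Z : Finset V) :
    ∑ w ∈ X, #(nb H w ∩ Z) = ∑ z ∈ Z, #(nb H z ∩ X) := by
  classical
  have := sum_card_bipartiteAbove_eq_sum_card_bipartiteBelow (s := X) (t := Z) H.Adj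
  convert this using 2 with w _ z _
  · congr 1; ext v; simp [bipartiteAbove, and_comm]
  · congr 1; ext v; simp [bipartiteBelow, and_comm, H.adj_comm]

theorem card_nbs_inter_le_mul {X Z : Finset V} {a : ℝ} (h : ∀ x ∈ X, (#(nb H x ∩ Z) : ℝ) ≤ a) :
    (#(nbs H X ∩ Z) : ℝ) ≤ #X * a := by
  calc (#(nbs H X ∩ Z) : ℝ) ≤ ∑ w ∈ X, (#(nb H w ∩ Z) : ℝ) := by
        exact_mod_cast card_nbs_inter_le_sum X Z
    _ ≤ #X * a := by simpa using sum_le_card_nsmul X _ a h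

/-- If few vertices of `Q` can be reached from sets that leave much of `Z₁` and `Z₂` unreached, then
vertices in `Q` typically have at most a small multiple of the degree of those in `Z₁ ∪ Z₂`. -/
theorem card_le_of_concave {U Z₁ Z₂ Q : Finset V} {κ lam σ W a b : ℝ}
    (hκ : κ ≤ σ / 4) (hσ : 0 < σ) (hlam : 0 < lam) (hlam8 : lam ≤ 1 / 8) (hW : 0 < W)
    (hU : ∀ w ∈ U, (#(nb H w) : ℝ) ≤ κ * W)
    (hconc : ∀ X ⊆ U, σ / 2 * W ≤ #(Z₁ \ nbs H X) → σ / 2 * W ≤ #(Z₂ \ nbs H X) →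
      (#(nbs H X ∩ Q) : ℝ) < lam * W)
    (hZ₁ : σ * W ≤ #Z₁) (hZ₂ : σ * W ≤ #Z₂) (hZ : (#(Z₁ ∪ Z₂) : ℝ) ≤ 2 * W)
    (ha : ∀ z ∈ Z₁ ∪ Z₂, (#(nb H z ∩ U) : ℝ) ≤ a)
    (hb : ∀ u ∈ Q, b < #(nb H u ∩ U)) (hab : 64 * lam * a / σ ≤ b) :
    (#Q : ℝ) ≤ W / 4 := by
  classical
  by_contra! hQ
  set Z := Z₁ ∪ Z₂ with hZdef
  let e : Finset V → ℝ := fun X => ∑ w ∈ X, (#(nb H w ∩ Z) : ℝ)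
  -- Take a largest `X` that reaches `Q` efficiently, gaining at least `4 * lam / σ` vertices of `Q`
  -- per edge into `Z`, within a budget of `σ / 2 * W` such edges. The budget leaves enough of `Z₁`
  -- and `Z₂` unreached for `hconc`, whose bound `lam * W` forces `e X < σ / 4 * W`. Half the budget
  -- is therefore left, enough for any further vertex since `κ ≤ σ / 4`.
  let S := U.powerset.filter fun X => 4 * lam / σ * e X ≤ #(nbs H X ∩ Q) ∧ e X ≤ σ / 2 * W
  have hS : S.Nonempty := ⟨∅, by
    simp only [S, e, mem_filter, mem_powerset]
    refine ⟨by simp, by simp, by simp; positivity⟩⟩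
  obtain ⟨X, hXS, hXmax⟩ := S.exists_max_image card hS
  obtain ⟨hXU, hX1, hX2⟩ : X ⊆ U ∧ 4 * lam / σ * e X ≤ #(nbs H X ∩ Q) ∧ e X ≤ σ / 2 * W := by
    simpa [S] using hXS
  have hcov : ∀ Z' ⊆ Z, σ * W ≤ #Z' → σ / 2 * W ≤ #(Z' \ nbs H X) := by
    intro Z' hZ' hc
    have h1 : (#(nbs H X ∩ Z') : ℝ) ≤ e X := by
      have h2 : #(nbs H X ∩ Z') ≤ #(nbs H X ∩ Z) := card_le_card (by gcongr)
      have h3 := card_nbs_inter_le_sum (H := H) X Z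
      have h4 : (#(nbs H X ∩ Z') : ℝ) ≤ ∑ w ∈ X, #(nb H w ∩ Z) := by exact_mod_cast h2.trans h3
      simpa [e] using h4
    have h2 : (#(Z' \ nbs H X) : ℝ) + #(nbs H X ∩ Z') = #Z' := by
      rw [inter_comm]; exact_mod_cast card_sdiff_add_card_inter Z' (nbs H X)
    linarith
  have hlt := hconc X hXU (hcov _ subset_union_left hZ₁) (hcov _ subset_union_right hZ₂)
  have heX : e X < σ / 4 * W := by
    have : 4 * lam / σ * e X < lam * W := hX1.trans_lt hlt
    rw [div_mul_eq_mul_div, div_lt_iff₀ hσ] at this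
    nlinarith
  set Q' := Q \ nbs H X
  have hQ' : W / 8 < #Q' := by
    have h2 : (#Q' : ℝ) + #(nbs H X ∩ Q) = #Q := by
      rw [inter_comm]; exact_mod_cast card_sdiff_add_card_inter Q (nbs H X)
    nlinarith
  -- By maximality no further vertex is efficient. Summing over `U` bounds the edges from `U` to
  -- `Q'` by those from `U` to `Z`, contradicting the degrees in `Q` because `Q'` has more than `W /
  -- 8` vertices.
  have hloc : ∀ w ∈ U, (#(nb H w ∩ Q') : ℝ) ≤ 4 * lam / σ * #(nb H w ∩ Z) := by
    intro w hw
    by_cases hwX : w ∈ X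
    · have : nb H w ∩ Q' = ∅ := by
        ext v
        simp only [mem_inter, mem_nb, Q', mem_sdiff, mem_nbs, notMem_empty, iff_false]
        rintro ⟨h1, h2, h3⟩
        exact h3 ⟨w, hwX, h1⟩
      rw [this]; simp; positivity
    · by_contra! hcon
      have he : e (insert w X) = #(nb H w ∩ Z) + e X := sum_insert hwX
      have hc : (#(nbs H (insert w X) ∩ Q) : ℝ) = #(nb H w ∩ Q') + #(nbs H X ∩ Q) := by
        have : nbs H (insert w X) ∩ Q = (nb H w ∩ Q') ∪ (nbs H X ∩ Q) := by
          rw [nbs_insert]; ext v; simp only [mem_inter, mem_union, Q', mem_sdiff]; tauto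
        rw [this, card_union_of_disjoint]
        · push_cast; rfl
        · rw [disjoint_left]; intro v; simp only [mem_inter, Q', mem_sdiff]; tauto
      have hmem : insert w X ∈ S := by
        simp only [S, mem_filter, mem_powerset, he, hc]
        refine ⟨insert_subset hw hXU, by rw [mul_add]; linarith, ?_⟩
        have h1 : (#(nb H w ∩ Z) : ℝ) ≤ κ * W :=
          le_trans (by exact_mod_cast card_le_card inter_subset_left) (hU w hw)
        nlinarith
      have := hXmax _ hmem
      rw [card_insert_of_notMem hwX] at this
      omega
  have hZne : Z.Nonempty := by
    have : (0 : ℝ) < #Z₁ := lt_of_lt_of_le (by positivity) hZ₁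
    exact (card_pos.1 (by exact_mod_cast this)).mono subset_union_left
  have ha0 : 0 ≤ a := by obtain ⟨z, hz⟩ := hZne; exact le_trans (by positivity) (ha z hz)
  have hb0 : 0 ≤ b := le_trans (by positivity) hab
  have hQne : Q'.Nonempty := by
    have : (0 : ℝ) < #Q' := lt_of_le_of_lt (by positivity) hQ'
    exact card_pos.1 (by exact_mod_cast this)
  have h1 : b * #Q' < ∑ u ∈ Q', (#(nb H u ∩ U) : ℝ) := by
    have := sum_lt_sum_of_nonempty hQne (f := fun _ => b) (g := fun u => (#(nb H u ∩ U) : ℝ))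
      fun u hu => hb u (sdiff_subset hu)
    simpa [mul_comm] using this
  have h2 : ∑ u ∈ Q', (#(nb H u ∩ U) : ℝ) = ∑ w ∈ U, (#(nb H w ∩ Q') : ℝ) := by
    exact_mod_cast sum_card_nb_inter_comm Q' U
  have h3 : ∑ w ∈ U, (#(nb H w ∩ Q') : ℝ) ≤ 4 * lam / σ * ∑ z ∈ Z, (#(nb H z ∩ U) : ℝ) := by
    have : ∑ z ∈ Z, (#(nb H z ∩ U) : ℝ) = ∑ w ∈ U, (#(nb H w ∩ Z) : ℝ) := by
      exact_mod_cast sum_card_nb_inter_comm Z U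
    rw [this, mul_sum]; exact sum_le_sum hloc
  have h4 : ∑ z ∈ Z, (#(nb H z ∩ U) : ℝ) ≤ a * (2 * W) := by
    calc ∑ z ∈ Z, (#(nb H z ∩ U) : ℝ) ≤ #Z * a := by simpa using sum_le_card_nsmul Z _ a ha
      _ ≤ _ := by rw [mul_comm]; gcongr
  have h5 : 4 * lam / σ * ∑ z ∈ Z, (#(nb H z ∩ U) : ℝ) ≤ 4 * lam / σ * (a * (2 * W)) := by gcongr
  have h6 : 64 * lam * a / σ * (W / 8) ≤ b * #Q' := by gcongr
  have h7 : 4 * lam / σ * (a * (2 * W)) = 64 * lam * a / σ * (W / 8) := by ring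
  linarith

end Neighbourhoods

/-! ### One round: typical degrees and light vertices. -/

/-- A graph with two families of `K` blocks of size `W`, as provided by a concave parade in a
coherent bigraph. -/
structure Host (V : Type*) [Fintype V] [DecidableEq V] where
  H : SimpleGraph V
  A : ℕ → Finset V
  B : ℕ → Finset V
  K : ℕ
  τ : ℕ
  W : ℝ
  κ : ℝ
  lam : ℝ
  one_lt_K : 1 < K
  W_pos : 0 < W
  lam_pos : 0 < lam
  lam_le : lam ≤ κ
  tau_lam : τ * lam ≤ κ
  kappa_le : κ ≤ 1 / 2 ^ 14
  card_A : ∀ i < K, (#(A i) : ℝ) = W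
  card_B : ∀ i < K, (#(B i) : ℝ) = W
  deg_A : ∀ i < K, ∀ v ∈ A i, (#(nb H v) : ℝ) ≤ κ * W
  deg_B : ∀ i < K, ∀ v ∈ B i, (#(nb H v) : ℝ) ≤ κ * W
  edge : ∀ i < K, ∀ j < K, ∀ X ⊆ A i, ∀ Y ⊆ B j, κ * W ≤ #X → κ * W ≤ #Y →
    ∃ x ∈ X, ∃ y ∈ Y, H.Adj x y
  conc_A : ∀ Y : Finset V, (∀ y ∈ Y, ∃ j < K, y ∈ B j) → ∀ h₁ h₂ h₃, h₁ < h₂ → h₂ < h₃ → h₃ < K →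
    lam * W ≤ #(A h₁ \ nbs H Y) → lam * W ≤ #(A h₃ \ nbs H Y) → (#(nbs H Y ∩ A h₂) : ℝ) < lam * W
  conc_B : ∀ Y : Finset V, (∀ y ∈ Y, ∃ j < K, y ∈ A j) → ∀ h₁ h₂ h₃, h₁ < h₂ → h₂ < h₃ → h₃ < K →
    lam * W ≤ #(B h₁ \ nbs H Y) → lam * W ≤ #(B h₃ \ nbs H Y) → (#(nbs H Y ∩ B h₂) : ℝ) < lam * W

namespace Host

variable {V : Type*} [Fintype V] [DecidableEq V]

/-- The outermost blocks among `B`, where centres are placed. -/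
def cen (S : Host V) (j : Bool) : ℕ := if j then 0 else S.K - 1

theorem cen_lt (S : Host V) (j : Bool) : S.cen j < S.K := by
  have := S.one_lt_K
  unfold cen; split <;> omega

theorem kappa_pos (S : Host V) : 0 < S.κ := S.lam_pos.trans_le S.lam_le

/-- The data of one round of attaching rooted copies to centres: outermost blocks for the roots,
available centres `C`, current contractions `CA`, `CB`, and for each kind (position of the root,
position of the centre) the copies that can be used. -/
structure Round (S : Host V) where
  i : Bool → ℕ
  C : Bool → Finset V
  CA : ℕ → Finset V
  CB : ℕ → Finset V
  ρ : ℝ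
  Cp : Bool × Bool → V → Finset V → Finset V → Prop
  i_lt : i true < i false
  i_lt_K : i false < S.K
  rho_pos : 0 < ρ
  rho_le : ρ ≤ 1
  kappa_le : S.κ ≤ ρ / 2 ^ 14
  C_sub : ∀ j, C j ⊆ S.B (S.cen j)
  C_card : ∀ j, ρ * S.W ≤ #(C j)
  CA_sub : ∀ h, i true ≤ h → h ≤ i false → CA h ⊆ S.A h
  CA_card : ∀ h, i true ≤ h → h ≤ i false → 3 / 4 * S.W ≤ #(CA h)
  CB_sub : ∀ h, 0 < h → h < S.K - 1 → CB h ⊆ S.B h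
  CB_card : ∀ h, 0 < h → h < S.K - 1 → 3 / 4 * S.W ≤ #(CB h)
  copies : ∀ (k : Bool × Bool) (X Y : ℕ → Finset V),
    (∀ h, i true ≤ h → h ≤ i false → X h ⊆ S.A h ∧ S.κ * S.W ≤ #(X h)) →
    (∀ h, 0 < h → h < S.K - 1 → Y h ⊆ S.B h ∧ S.κ * S.W ≤ #(Y h)) →
    ∃ r FA FB, Cp k r FA FB ∧ r ∈ X (i k.1) ∧
      (∀ v ∈ FA, ∃ h, i true < h ∧ h < i false ∧ v ∈ X h) ∧
      (∀ v ∈ FB, ∃ h, 0 < h ∧ h < S.K - 1 ∧ v ∈ Y h) ∧ #FA ≤ S.τ ∧ #FB ≤ S.τ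

namespace Round

variable {S : Host V} (R : S.Round)

theorem i_bounds (e : Bool) : R.i true ≤ R.i e ∧ R.i e ≤ R.i false := by
  have := R.i_lt
  cases e <;> simp <;> omega

/-- `w` is adjacent to the root, and no other vertex, of a suitable copy of kind `k`. -/
def Serves (k : Bool × Bool) (MA MB : Finset V) (w : V) : Prop :=
  ∃ r FA FB, R.Cp k r FA FB ∧ S.H.Adj w r ∧ (∀ u ∈ FA, ¬ S.H.Adj w u) ∧
    r ∈ R.CA (R.i k.1) ∧ (∀ v ∈ FA, ∃ h, R.i true < h ∧ h < R.i false ∧ v ∈ R.CA h) ∧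
    (∀ v ∈ FB, ∃ h, 0 < h ∧ h < S.K - 1 ∧ v ∈ R.CB h) ∧ r ∈ MA ∧ FA ⊆ MA ∧ FB ⊆ MB

theorem Serves.mono {R : S.Round} {k MA MB MA' MB' w} (h : R.Serves k MA MB w) (hA : MA ⊆ MA')
    (hB : MB ⊆ MB') : R.Serves k MA' MB' w := by
  obtain ⟨r, FA, FB, h1, h2, h3, h4, h5, h6, h7, h8, h9⟩ := h
  exact ⟨r, FA, FB, h1, h2, h3, h4, h5, h6, hA h7, h8.trans hA, h9.trans hB⟩

/-- A reference set of root candidates of which many centres have at most `d` neighbours. -/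
def Light (d : ℕ) (Γ Y : Bool → Finset V) : Prop :=
  (∀ e, Γ e ⊆ R.CA (R.i e) ∧ S.W / 4 ≤ #(Γ e)) ∧
  (∀ j, Y j ⊆ R.C j ∧ (#(R.C j) : ℝ) / 4 ≤ #(Y j) ∧
    ∀ y ∈ Y j, #(nb S.H y ∩ (Γ true ∪ Γ false)) ≤ d)

/-- The state of the greedy construction. -/
structure State (Γ : Finset V) where
  Sv : Bool × Bool → Finset V
  MA : Finset V
  MB : Finset V
  Sv_sub : ∀ k, Sv k ⊆ R.C k.2
  serves : ∀ k, ∀ w ∈ Sv k, R.Serves k MA MB w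
  MA_mem : ∀ v ∈ MA, ∃ h < S.K, v ∈ S.A h
  MB_mem : ∀ v ∈ MB, ∃ h < S.K, v ∈ S.B h
  MA_nbs : #(nbs S.H MA ∩ (R.C true ∪ R.C false)) ≤ 3 * ∑ k, #(Sv k)
  MB_nbs : (#(nbs S.H MB ∩ Γ) : ℝ) ≤ 2 ^ 13 * S.κ / R.ρ ^ 2 * ∑ k, #(Sv k)

/-- The number of centres served, with multiplicity. -/
def State.n {R : S.Round} {Γ} (s : R.State Γ) : ℕ := ∑ k, #(s.Sv k)

/-- The centres not yet touched. -/
noncomputable def State.U {R : S.Round} {Γ} (s : R.State Γ) (j : Bool) : Finset V :=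
  R.C j \ nbs S.H s.MA

/-- The reference sets fix a scale for degrees between centres and root candidates. Minimality of
`d` is what later forces the remaining roots to keep a comparable degree. -/
theorem exists_light : ∃ d Γ Y, R.Light d Γ Y ∧ ∀ d' < d, ∀ Γ' Y', ¬ R.Light d' Γ' Y' := by
  classical
  have h : ∃ d, ∃ Γ Y, R.Light d Γ Y := by
    refine ⟨Fintype.card V, fun e => R.CA (R.i e), R.C, fun e => ⟨subset_rfl, ?_⟩,
      fun j => ⟨subset_rfl, ?_, fun y _ => card_le_univ _⟩⟩
    · have := R.CA_card _ (R.i_bounds e).1 (R.i_bounds e).2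
      linarith [S.W_pos]
    · linarith [show (0 : ℝ) ≤ #(R.C j) by positivity]
  obtain ⟨Γ, Y, h1⟩ := Nat.find_spec h
  exact ⟨Nat.find h, Γ, Y, h1, fun d' hd' Γ' Y' h' => Nat.find_min h hd' ⟨Γ', Y', h'⟩⟩

/-- At most three centres are touched per centre served, hence at most 3/8 of each set of centres.
-/
theorem U_card {Γ} (s : R.State Γ) (hs : (s.n : ℝ) ≤ R.ρ * S.W / 8) (j : Bool) :
    5 / 8 * (#(R.C j) : ℝ) ≤ #(s.U j) := by
  have h1 : (#(s.U j) : ℝ) + #(R.C j ∩ nbs S.H s.MA) = #(R.C j) := by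
    exact_mod_cast card_sdiff_add_card_inter _ _
  have h2 : (#(R.C j ∩ nbs S.H s.MA) : ℝ) ≤ 3 * s.n := by
    have h3 : R.C j ∩ nbs S.H s.MA ⊆ nbs S.H s.MA ∩ (R.C true ∪ R.C false) := by
      intro v; simp only [mem_inter, mem_union]; cases j <;> tauto
    exact_mod_cast (card_le_card h3).trans s.MA_nbs
  have := R.C_card j
  linarith

theorem U_sub {Γ} (s : R.State Γ) (j : Bool) : s.U j ⊆ S.B (S.cen j) :=
  sdiff_subset.trans (R.C_sub j)

/-- The degree `a` such that many root candidates have at least `a` untouched centres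
as neighbours, while few have more. -/
theorem exists_typical_degree {Γ} (s : R.State Γ) (hs : (s.n : ℝ) ≤ R.ρ * S.W / 8) :
    ∃ a : ℕ, 0 < a ∧
      (∃ e, S.W / 4 ≤ #{r ∈ R.CA (R.i e) | a ≤ #(nb S.H r ∩ (s.U true ∪ s.U false))}) ∧
      ∀ e, S.W / 2 ≤ #{r ∈ R.CA (R.i e) | #(nb S.H r ∩ (s.U true ∪ s.U false)) ≤ a} := by
  classical
  set U := s.U true ∪ s.U false with hU
  let p : ℕ → Prop := fun a => ∃ e, S.W / 4 ≤ #{r ∈ R.CA (R.i e) | a ≤ #(nb S.H r ∩ U)}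
  have hW := S.W_pos
  have hCA : ∀ e, 3 / 4 * S.W ≤ #(R.CA (R.i e)) :=
    fun e => R.CA_card _ (R.i_bounds e).1 (R.i_bounds e).2
  have hk := R.kappa_le
  have hk' := S.kappa_le
  have hp : ∃ a, ¬ p a := by
    refine ⟨Fintype.card V + 1, ?_⟩
    rintro ⟨e, he⟩
    rw [filter_false_of_mem] at he
    · simp at he; linarith
    · intro r _ h
      have := card_le_univ (nb S.H r ∩ U)
      omega
  have p0 : p 0 := ⟨true, by simp; linarith [hCA true]⟩
  -- Otherwise more than `W / 2` root candidates have no untouched neighbour, against `edge`. This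
  -- is what makes the typical degree positive.
  have p1 : p 1 := by
    refine ⟨true, ?_⟩
    by_contra! hc
    have h1 : (#{r ∈ R.CA (R.i true) | 1 ≤ #(nb S.H r ∩ U)} : ℝ) +
        #{r ∈ R.CA (R.i true) | ¬ 1 ≤ #(nb S.H r ∩ U)} = #(R.CA (R.i true)) := by
      exact_mod_cast card_filter_add_card_filter_not _
    have h2 := R.U_card s hs true
    have h3 := R.C_card true
    obtain ⟨x, hx, y, hy, hxy⟩ := S.edge (R.i true) (R.i_lt.trans R.i_lt_K) _ (S.cen_lt true)
      {r ∈ R.CA (R.i true) | ¬ 1 ≤ #(nb S.H r ∩ U)}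
      ((filter_subset _ _).trans (R.CA_sub _ le_rfl R.i_lt.le)) (s.U true) (R.U_sub s true)
      (by nlinarith [hCA true]) (by nlinarith [hCA true])
    rw [mem_filter] at hx
    exact hx.2 (card_pos.2 ⟨y, by simp [hU, hxy, hy]⟩)
  -- The typical degree is one below the first failing threshold: `a` itself is attained often at
  -- one end, and `a + 1` rarely at either end.
  obtain ⟨m, hm1, hm2⟩ : ∃ m, ¬ p m ∧ ∀ a < m, p a :=
    ⟨Nat.find hp, Nat.find_spec hp, fun a ha => not_not.1 (Nat.find_min hp ha)⟩
  have hm3 : 2 ≤ m := by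
    by_contra! h
    interval_cases m <;> tauto
  obtain ⟨a, rfl⟩ : ∃ a, m = a + 1 := ⟨m - 1, by omega⟩
  refine ⟨a, by omega, hm2 a (by omega), fun e => ?_⟩
  have h1 : (#{r ∈ R.CA (R.i e) | a + 1 ≤ #(nb S.H r ∩ U)} : ℝ) +
      #{r ∈ R.CA (R.i e) | ¬ a + 1 ≤ #(nb S.H r ∩ U)} = #(R.CA (R.i e)) := by
    exact_mod_cast card_filter_add_card_filter_not _
  have h2 : (#{r ∈ R.CA (R.i e) | a + 1 ≤ #(nb S.H r ∩ U)} : ℝ) < S.W / 4 := by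
    by_contra! h; exact hm1 ⟨e, h⟩
  simp only [not_le, Nat.lt_succ_iff] at h1
  linarith [hCA e]

/-- Root candidates of degree at most `a` would serve as reference sets for `d - 1` if enough
untouched centres had at most `d - 1` neighbours among them. So at one of the two positions at least
`ρ * W / 4` untouched centres have `d` or more such neighbours. Counting these edges from both sides
gives `ρ * W / 4 * d ≤ 2 * W * a`. -/
theorem light_le {Γ} (s : R.State Γ) (hs : (s.n : ℝ) ≤ R.ρ * S.W / 8) {d : ℕ}
    (hd : ∀ d' < d, ∀ Γ' Y', ¬ R.Light d' Γ' Y') {a : ℕ}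
    (ha : ∀ e, S.W / 2 ≤ #{r ∈ R.CA (R.i e) | #(nb S.H r ∩ (s.U true ∪ s.U false)) ≤ a}) :
    R.ρ * d / 8 ≤ a := by
  classical
  obtain rfl | hd0 := Nat.eq_zero_or_pos d
  · simp
  set U := s.U true ∪ s.U false with hU
  let Z : Bool → Finset V := fun e => {r ∈ R.CA (R.i e) | #(nb S.H r ∩ U) ≤ a}
  set G := Z true ∪ Z false with hG
  have hW := S.W_pos
  obtain ⟨j, hj⟩ : ∃ j, (#{y ∈ s.U j | #(nb S.H y ∩ G) ≤ d - 1} : ℝ) < (#(R.C j) : ℝ) / 4 := by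
    by_contra! h
    refine hd (d - 1) (by omega) Z (fun j => {y ∈ s.U j | #(nb S.H y ∩ G) ≤ d - 1})
      ⟨fun e => ⟨filter_subset _ _, ?_⟩, fun j => ⟨(filter_subset _ _).trans sdiff_subset, h j, ?_⟩⟩
    · have := ha e; simp only [Z]; linarith
    · intro y hy; exact (mem_filter.1 hy).2
  have h1 : (#{y ∈ s.U j | #(nb S.H y ∩ G) ≤ d - 1} : ℝ) +
      #{y ∈ s.U j | ¬ #(nb S.H y ∩ G) ≤ d - 1} = #(s.U j) := by
    exact_mod_cast card_filter_add_card_filter_not _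
  set D := {y ∈ s.U j | ¬ #(nb S.H y ∩ G) ≤ d - 1}
  have h2 := R.U_card s hs j
  have h3 := R.C_card j
  have h4 : R.ρ * S.W / 4 ≤ #D := by nlinarith [mul_pos R.rho_pos hW]
  have h5 : (#D : ℝ) * d ≤ ∑ y ∈ D, (#(nb S.H y ∩ G) : ℝ) := by
    have : ∀ y ∈ D, (d : ℝ) ≤ (#(nb S.H y ∩ G) : ℝ) := by
      intro y hy
      have := (mem_filter.1 hy).2
      exact_mod_cast (by omega : d ≤ #(nb S.H y ∩ G))
    simpa using card_nsmul_le_sum D _ _ this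
  have h6 : ∑ y ∈ D, (#(nb S.H y ∩ G) : ℝ) = ∑ z ∈ G, (#(nb S.H z ∩ D) : ℝ) := by
    exact_mod_cast sum_card_nb_inter_comm D G
  have h7 : ∑ z ∈ G, (#(nb S.H z ∩ D) : ℝ) ≤ #G * a := by
    have : ∀ z ∈ G, (#(nb S.H z ∩ D) : ℝ) ≤ a := by
      intro z hz
      have h8 : #(nb S.H z ∩ D) ≤ #(nb S.H z ∩ U) := by
        apply card_le_card
        have : D ⊆ U := (filter_subset _ _).trans (by
          cases j
          exacts [subset_union_right, subset_union_left])
        gcongr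
      have h9 : #(nb S.H z ∩ U) ≤ a := by
        rw [hG, mem_union] at hz
        rcases hz with hz | hz <;> exact (mem_filter.1 hz).2
      exact_mod_cast h8.trans h9
    simpa using sum_le_card_nsmul G _ _ this
  have h8 : (#G : ℝ) ≤ 2 * S.W := by
    have hz : ∀ e, (#(Z e) : ℝ) ≤ S.W := by
      intro e
      rw [← S.card_A (R.i e) ((R.i_bounds e).2.trans_lt R.i_lt_K)]
      exact_mod_cast card_le_card ((filter_subset _ _).trans
        (R.CA_sub _ (R.i_bounds e).1 (R.i_bounds e).2))
    have : (#G : ℝ) ≤ #(Z true) + #(Z false) := by exact_mod_cast card_union_le _ _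
    linarith [hz true, hz false]
  have h9 : R.ρ * S.W / 4 * d ≤ 2 * S.W * a := by
    calc R.ρ * S.W / 4 * d ≤ #D * d := by gcongr
      _ ≤ #G * a := by linarith
      _ ≤ _ := by gcongr
  have : S.W * (R.ρ * d / 8) ≤ S.W * a := by nlinarith
  exact le_of_mul_le_mul_left this hW

theorem cen_true_lt {h : ℕ} (h0 : 0 < h) : S.cen true < h := by simpa [cen] using h0

theorem lt_cen_false {h : ℕ} (h0 : h < S.K - 1) : h < S.cen false := by simpa [cen] using h0

/-- An instance of `card_le_of_concave` with the untouched centres as `U` and the candidates of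
degree at most `a` in the two outer blocks as `Z₁`, `Z₂`; with `σ = 1 / 2` the constant is `64 / σ =
128`. -/
theorem card_heavy_A {Γ} (s : R.State Γ) {a : ℕ}
    (ha : ∀ e, S.W / 2 ≤ #{r ∈ R.CA (R.i e) | #(nb S.H r ∩ (s.U true ∪ s.U false)) ≤ a})
    {h : ℕ} (h1 : R.i true < h) (h2 : h < R.i false) :
    (#{u ∈ R.CA h | 128 * S.lam * a < #(nb S.H u ∩ (s.U true ∪ s.U false))} : ℝ) ≤ S.W / 4 := by
  classical
  set U := s.U true ∪ s.U false with hU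
  let Z : Bool → Finset V := fun e => {r ∈ R.CA (R.i e) | #(nb S.H r ∩ U) ≤ a}
  have hZA : ∀ e, Z e ⊆ S.A (R.i e) := fun e =>
    (filter_subset _ _).trans (R.CA_sub _ (R.i_bounds e).1 (R.i_bounds e).2)
  have hz : ∀ e, (#(Z e) : ℝ) ≤ S.W := by
    intro e
    rw [← S.card_A (R.i e) ((R.i_bounds e).2.trans_lt R.i_lt_K)]
    exact_mod_cast card_le_card (hZA e)
  have hUB : ∀ w ∈ U, ∃ j < S.K, w ∈ S.B j := by
    intro w hw
    rw [hU, mem_union] at hw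
    rcases hw with hw | hw
    exacts [⟨_, S.cen_lt true, R.U_sub s true hw⟩, ⟨_, S.cen_lt false, R.U_sub s false hw⟩]
  have hW := S.W_pos
  have hl := S.lam_le
  have hk := S.kappa_le
  refine card_le_of_concave (H := S.H) (U := U) (Z₁ := Z true) (Z₂ := Z false) (κ := S.κ)
    (lam := S.lam) (σ := 1 / 2) (a := a) (b := 128 * S.lam * a) (by linarith) (by norm_num)
    S.lam_pos (by linarith) hW ?_ ?_ (by linarith [ha true]) (by linarith [ha false]) ?_ ?_ ?_
    (by ring_nf; rfl)
  · intro w hw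
    obtain ⟨j, hj, hwj⟩ := hUB w hw
    exact S.deg_B j hj w hwj
  · intro X hX hX1 hX2
    have hle : ∀ e, (#(Z e \ nbs S.H X) : ℝ) ≤ #(S.A (R.i e) \ nbs S.H X) := by
      intro e; exact_mod_cast card_le_card (sdiff_subset_sdiff (hZA e) subset_rfl)
    have := S.conc_A X (fun y hy => hUB y (hX hy)) _ _ _ h1 h2 R.i_lt_K
      (by nlinarith [hle true]) (by nlinarith [hle false])
    refine lt_of_le_of_lt ?_ this
    exact_mod_cast card_le_card (inter_subset_inter_left
      ((filter_subset _ _).trans (R.CA_sub h h1.le h2.le)))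
  · have : (#(Z true ∪ Z false) : ℝ) ≤ #(Z true) + #(Z false) := by exact_mod_cast card_union_le _ _
    linarith [hz true, hz false]
  · intro z hz
    rw [mem_union] at hz
    rcases hz with hz | hz <;> exact_mod_cast (mem_filter.1 hz).2
  · intro u hu
    exact (mem_filter.1 hu).2

/-- The mirror image of `card_heavy_A`: the reference roots act as `U`, and the centres with at most
`d` neighbours among them act as `Z₁`, `Z₂`. Here `σ = ρ / 4`, whence `256 / ρ`. -/
theorem card_heavy_B {d : ℕ} {Γ Y} (hL : R.Light d Γ Y) {h : ℕ} (h1 : 0 < h) (h2 : h < S.K - 1) :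
    (#{u ∈ R.CB h | 256 * S.lam * d / R.ρ < #(nb S.H u ∩ (Γ true ∪ Γ false))} : ℝ) ≤ S.W / 4 := by
  classical
  have hYB : ∀ j, Y j ⊆ S.B (S.cen j) := fun j => (hL.2 j).1.trans (R.C_sub j)
  have hz : ∀ e, (#(Y e) : ℝ) ≤ S.W := by
    intro e
    rw [← S.card_B (S.cen e) (S.cen_lt e)]
    exact_mod_cast card_le_card (hYB e)
  have hΓ : ∀ w ∈ Γ true ∪ Γ false, ∃ j < S.K, w ∈ S.A j := by
    intro w hw
    have : ∀ e, Γ e ⊆ S.A (R.i e) := fun e =>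
      (hL.1 e).1.trans (R.CA_sub _ (R.i_bounds e).1 (R.i_bounds e).2)
    rw [mem_union] at hw
    rcases hw with hw | hw
    exacts [⟨_, R.i_lt.trans R.i_lt_K, this true hw⟩, ⟨_, R.i_lt_K, this false hw⟩]
  have hW := S.W_pos
  have hl := S.lam_le
  have hk := S.kappa_le
  have hk' := R.kappa_le
  have hρ := R.rho_pos
  have hYc : ∀ j, R.ρ / 4 * S.W ≤ #(Y j) := fun j => by
    linarith [(hL.2 j).2.1, R.C_card j]
  refine card_le_of_concave (H := S.H) (U := Γ true ∪ Γ false) (Z₁ := Y true) (Z₂ := Y false)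
    (κ := S.κ) (lam := S.lam) (σ := R.ρ / 4) (a := d) (b := 256 * S.lam * d / R.ρ)
    (by linarith) (by linarith) S.lam_pos (by linarith) hW ?_ ?_ (hYc true) (hYc false) ?_ ?_ ?_
    (by apply le_of_eq; field_simp; ring)
  · intro w hw
    obtain ⟨j, hj, hwj⟩ := hΓ w hw
    exact S.deg_A j hj w hwj
  · intro X hX hX1 hX2
    have hle : ∀ e, (#(Y e \ nbs S.H X) : ℝ) ≤ #(S.B (S.cen e) \ nbs S.H X) := by
      intro e; exact_mod_cast card_le_card (sdiff_subset_sdiff (hYB e) subset_rfl)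
    have hlρ : S.lam * S.W ≤ R.ρ / 4 / 2 * S.W := by gcongr; linarith
    have := S.conc_B X (fun y hy => hΓ y (hX hy)) (S.cen true) h (S.cen false)
      (cen_true_lt h1) (lt_cen_false h2) (S.cen_lt false)
      (by linarith [hle true]) (by linarith [hle false])
    refine lt_of_le_of_lt ?_ this
    exact_mod_cast card_le_card (inter_subset_inter_left
      ((filter_subset _ _).trans (R.CB_sub h h1 h2)))
  · have : (#(Y true ∪ Y false) : ℝ) ≤ #(Y true) + #(Y false) := by exact_mod_cast card_union_le _ _
    linarith [hz true, hz false]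
  · intro z hz
    rw [mem_union] at hz
    rcases hz with hz | hz
    · exact_mod_cast (hL.2 true).2.2 z hz
    · exact_mod_cast (hL.2 false).2.2 z hz
  · intro u hu
    exact (mem_filter.1 hu).2

end Round

end Host

/-! ### One round: the greedy choice of copies. -/

namespace Host

variable {V : Type*} [Fintype V] [DecidableEq V]

namespace Round

variable {S : Host V} (R : S.Round)

omit [Fintype V] [DecidableEq V] in
theorem half_le_card_filter {X : Finset V} {p : V → Prop} [DecidablePred p] {w : ℝ}
    (hX : 3 / 4 * w ≤ #X) (hp : (#{u ∈ X | p u} : ℝ) ≤ w / 4) :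
    w / 2 ≤ #{u ∈ X | ¬ p u} := by
  have h1 : (#{u ∈ X | p u} : ℝ) + #{u ∈ X | ¬ p u} = #X := by
    exact_mod_cast card_filter_add_card_filter_not _
  linarith

/-- Each root has at least half of its untouched neighbours in one of the two sets of centres, and
one of the two is right for half of the roots. -/
theorem exists_root_pool {X U₁ U₂ : Finset V} {a : ℕ} {w : ℝ}
    (h : w / 4 ≤ #{r ∈ X | a ≤ #(nb S.H r ∩ (U₁ ∪ U₂))}) :
    w / 8 ≤ #{r ∈ X | a ≤ #(nb S.H r ∩ (U₁ ∪ U₂)) ∧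
        #(nb S.H r ∩ (U₁ ∪ U₂)) ≤ 2 * #(nb S.H r ∩ U₁)} ∨
      w / 8 ≤ #{r ∈ X | a ≤ #(nb S.H r ∩ (U₁ ∪ U₂)) ∧
        #(nb S.H r ∩ (U₁ ∪ U₂)) ≤ 2 * #(nb S.H r ∩ U₂)} := by
  by_contra! hc
  have h1 : {r ∈ X | a ≤ #(nb S.H r ∩ (U₁ ∪ U₂))} ⊆
      {r ∈ X | a ≤ #(nb S.H r ∩ (U₁ ∪ U₂)) ∧
        #(nb S.H r ∩ (U₁ ∪ U₂)) ≤ 2 * #(nb S.H r ∩ U₁)} ∪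
      {r ∈ X | a ≤ #(nb S.H r ∩ (U₁ ∪ U₂)) ∧
        #(nb S.H r ∩ (U₁ ∪ U₂)) ≤ 2 * #(nb S.H r ∩ U₂)} := by
    intro r hr
    rw [mem_filter] at hr
    have : #(nb S.H r ∩ (U₁ ∪ U₂)) ≤ #(nb S.H r ∩ U₁) + #(nb S.H r ∩ U₂) := by
      rw [inter_union_distrib_left]; exact card_union_le _ _
    simp only [mem_union, mem_filter, hr, true_and]
    omega
  have h3 := (Nat.cast_le (α := ℝ)).2 ((card_le_card h1).trans (card_union_le _ _))
  push_cast at h3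
  linarith [hc.1, hc.2]

/-- A copy whose root is typical and whose other vertices have few neighbours among the untouched
centres and the reference roots. -/
theorem exists_light_copy {d : ℕ} {Γ Y} (hL : R.Light d Γ Y) (s : R.State (Γ true ∪ Γ false))
    {a : ℕ} {e : Bool}
    (hae : S.W / 4 ≤ #{r ∈ R.CA (R.i e) | a ≤ #(nb S.H r ∩ (s.U true ∪ s.U false))})
    (haZ : ∀ e, S.W / 2 ≤ #{r ∈ R.CA (R.i e) | #(nb S.H r ∩ (s.U true ∪ s.U false)) ≤ a}) :
    ∃ j r FA FB, R.Cp (e, j) r FA FB ∧ r ∈ R.CA (R.i e) ∧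
      a ≤ #(nb S.H r ∩ (s.U true ∪ s.U false)) ∧
      #(nb S.H r ∩ (s.U true ∪ s.U false)) ≤ 2 * #(nb S.H r ∩ s.U j) ∧
      (∀ v ∈ FA, ∃ h, R.i true < h ∧ h < R.i false ∧ v ∈ R.CA h ∧
        (#(nb S.H v ∩ (s.U true ∪ s.U false)) : ℝ) ≤ 128 * S.lam * a) ∧
      (∀ v ∈ FB, ∃ h, 0 < h ∧ h < S.K - 1 ∧ v ∈ R.CB h ∧
        (#(nb S.H v ∩ (Γ true ∪ Γ false)) : ℝ) ≤ 256 * S.lam * d / R.ρ) ∧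
      #FA ≤ S.τ ∧ #FB ≤ S.τ := by
  classical
  have hW := S.W_pos
  have hκ := S.kappa_le
  have hκW8 : S.κ * S.W ≤ S.W / 8 := by
    rw [div_eq_inv_mul]; gcongr; linarith
  obtain ⟨j, hj⟩ : ∃ j, S.W / 8 ≤ #{r ∈ R.CA (R.i e) | a ≤ #(nb S.H r ∩ (s.U true ∪ s.U false)) ∧
      #(nb S.H r ∩ (s.U true ∪ s.U false)) ≤ 2 * #(nb S.H r ∩ s.U j)} := by
    rcases exists_root_pool hae with h | h
    exacts [⟨true, h⟩, ⟨false, h⟩]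
  generalize hU : s.U true ∪ s.U false = U at *
  obtain ⟨RX, hRX⟩ : ∃ RX : Finset V, RX = {r ∈ R.CA (R.i e) |
      a ≤ #(nb S.H r ∩ U) ∧ #(nb S.H r ∩ U) ≤ 2 * #(nb S.H r ∩ s.U j)} := ⟨_, rfl⟩
  rw [← hRX] at hj
  -- The root's block is cut down to typical roots and the inner blocks to light vertices; the other
  -- outer block contains no vertex of the copy and needs no pruning. All remaining sets exceed `κ *
  -- W`, as `copies` requires.
  obtain ⟨X, hXdef⟩ : ∃ X : ℕ → Finset V, X = fun h => if h = R.i e then RX else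
    if R.i true < h ∧ h < R.i false then {u ∈ R.CA h | ¬ 128 * S.lam * a < #(nb S.H u ∩ U)}
    else R.CA h := ⟨_, rfl⟩
  obtain ⟨Y', hYdef⟩ : ∃ Y' : ℕ → Finset V, Y' = fun h =>
    {u ∈ R.CB h | ¬ 256 * S.lam * d / R.ρ < #(nb S.H u ∩ (Γ true ∪ Γ false))} := ⟨_, rfl⟩
  have hne : ∀ h, R.i true < h → h < R.i false → h ≠ R.i e := by
    intro h h1 h2; cases e <;> omega
  have hX : ∀ h, R.i true ≤ h → h ≤ R.i false → X h ⊆ S.A h ∧ S.κ * S.W ≤ #(X h) := by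
    intro h h1 h2
    simp only [hXdef]
    split_ifs with h3 h4
    · subst h3
      rw [hRX] at hj ⊢
      exact ⟨(filter_subset _ _).trans (R.CA_sub _ h1 h2), by linarith⟩
    · refine ⟨(filter_subset _ _).trans (R.CA_sub _ h1 h2), ?_⟩
      subst hU
      have := half_le_card_filter (R.CA_card h h1 h2) (R.card_heavy_A s haZ h4.1 h4.2)
      linarith
    · exact ⟨R.CA_sub _ h1 h2, by linarith [R.CA_card h h1 h2]⟩
  have hY : ∀ h, 0 < h → h < S.K - 1 → Y' h ⊆ S.B h ∧ S.κ * S.W ≤ #(Y' h) := by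
    intro h h1 h2
    simp only [hYdef]
    refine ⟨(filter_subset _ _).trans (R.CB_sub _ h1 h2), ?_⟩
    have := half_le_card_filter (R.CB_card h h1 h2) (R.card_heavy_B hL h1 h2)
    linarith
  obtain ⟨r, FA, FB, hCp, hr, hFA, hFB, hFAc, hFBc⟩ := R.copies (e, j) X Y' hX hY
  simp only [hXdef, if_true, hRX] at hr
  rw [mem_filter] at hr
  refine ⟨j, r, FA, FB, hCp, hr.1, hr.2.1, hr.2.2, ?_, ?_, hFAc, hFBc⟩
  · intro v hv
    obtain ⟨h, h1, h2, h3⟩ := hFA v hv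
    simp only [hXdef, hne h h1 h2, if_false, h1, h2, and_self, if_true, mem_filter, not_lt] at h3
    exact ⟨h, h1, h2, h3⟩
  · intro v hv
    obtain ⟨h, h1, h2, h3⟩ := hFB v hv
    simp only [hYdef, mem_filter, not_lt] at h3
    exact ⟨h, h1, h2, h3⟩

omit [Fintype V] in
theorem sum_card_update (f : Bool × Bool → Finset V) (k : Bool × Bool) {New : Finset V}
    (h : Disjoint (f k) New) :
    ∑ l, #((Function.update f k (f k ∪ New)) l) = ∑ l, #(f l) + #New := by
  have h1 : (fun l => #((Function.update f k (f k ∪ New)) l)) =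
      Function.update (fun l => #(f l)) k (#(f k) + #New) := by
    ext l
    by_cases hl : l = k
    · subst hl; simp [card_union_of_disjoint h]
    · simp [hl]
  rw [h1, sum_update_of_mem (mem_univ _), ← add_sum_erase univ _ (mem_univ k),
    sdiff_singleton_eq_erase]
  ring

/-- Let `x` be the number of untouched neighbours of `r`. At least `x / 2` of them are of the chosen
kind and at most `x / 8` are lost to `FA`, so at least `3 * x / 8` centres are newly served. At most
`9 * x / 8` are newly touched, exactly three times as many, which is the ratio in `MA_nbs`. -/
theorem State.exists_extension {R : S.Round} {Γ} (s : R.State Γ) {e j : Bool} {r : V}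
    {FA FB : Finset V} (hCp : R.Cp (e, j) r FA FB) (hrCA : r ∈ R.CA (R.i e))
    (hFA : ∀ v ∈ FA, ∃ h, R.i true < h ∧ h < R.i false ∧ v ∈ R.CA h)
    (hFB : ∀ v ∈ FB, ∃ h, 0 < h ∧ h < S.K - 1 ∧ v ∈ R.CB h)
    (hx0 : 0 < #(nb S.H r ∩ (s.U true ∪ s.U false)))
    (hrj : #(nb S.H r ∩ (s.U true ∪ s.U false)) ≤ 2 * #(nb S.H r ∩ s.U j))
    (hcovA : (#(nbs S.H FA ∩ (s.U true ∪ s.U false)) : ℝ) ≤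
      #(nb S.H r ∩ (s.U true ∪ s.U false)) / 8)
    (hcovB : (#(nbs S.H FB ∩ Γ) : ℝ) ≤
      2 ^ 13 * S.κ / R.ρ ^ 2 * (#(nb S.H r ∩ (s.U true ∪ s.U false)) / 4)) :
    ∃ s' : R.State Γ, s.n < s'.n ∧ (s'.n : ℝ) ≤ s.n + S.κ * S.W := by
  have hrA : r ∈ S.A (R.i e) := R.CA_sub _ (R.i_bounds e).1 (R.i_bounds e).2 hrCA
  have hκ0 := S.kappa_pos
  have hρ := R.rho_pos
  generalize hU : s.U true ∪ s.U false = U at *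
  generalize hx : #(nb S.H r ∩ U) = x at *
  have hx0' : (0 : ℝ) < x := by exact_mod_cast hx0
  obtain ⟨New, hNew⟩ : ∃ New : Finset V, New = (nb S.H r ∩ s.U j) \ nbs S.H FA := ⟨_, rfl⟩
  have hUj : s.U j ⊆ U := by
    rw [← hU]
    cases j
    exacts [subset_union_right, subset_union_left]
  have hNewc : 3 / 8 * (x : ℝ) ≤ #New := by
    have h1 : (#New : ℝ) + #((nb S.H r ∩ s.U j) ∩ nbs S.H FA) = #(nb S.H r ∩ s.U j) := by
      rw [hNew]; exact_mod_cast card_sdiff_add_card_inter _ _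
    have h2 : (#((nb S.H r ∩ s.U j) ∩ nbs S.H FA) : ℝ) ≤ #(nbs S.H FA ∩ U) := by
      have : (nb S.H r ∩ s.U j) ∩ nbs S.H FA ⊆ nbs S.H FA ∩ U := by
        intro v; simp only [mem_inter]; exact fun h => ⟨h.2, hUj h.1.2⟩
      exact_mod_cast card_le_card this
    have h3 : (x : ℝ) ≤ 2 * #(nb S.H r ∩ s.U j) := by exact_mod_cast hrj
    linarith
  have hNewle : (#New : ℝ) ≤ S.κ * S.W := by
    refine le_trans ?_ (S.deg_A _ ((R.i_bounds e).2.trans_lt R.i_lt_K) r hrA)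
    rw [hNew]
    exact_mod_cast card_le_card (sdiff_subset.trans inter_subset_left)
  -- A served centre is adjacent to a root in `MA`, hence is no longer untouched.
  have hdis : Disjoint (s.Sv (e, j)) New := by
    rw [disjoint_left, hNew]
    intro w hw hw'
    obtain ⟨r', FA', FB', -, h2, -, -, -, -, h7, -⟩ := s.serves _ w hw
    have : w ∈ s.U j := (mem_inter.1 (mem_sdiff.1 hw').1).2
    exact (mem_sdiff.1 this).2 (mem_nbs.2 ⟨r', h7, h2.symm⟩)
  have hsum := sum_card_update s.Sv (e, j) hdis
  have hA : s.MA ⊆ s.MA ∪ insert r FA := subset_union_left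
  have hB : s.MB ⊆ s.MB ∪ FB := subset_union_left
  have hserve : ∀ k, ∀ w ∈ Function.update s.Sv (e, j) (s.Sv (e, j) ∪ New) k,
      R.Serves k (s.MA ∪ insert r FA) (s.MB ∪ FB) w := by
    intro k w hw
    by_cases hk : k = (e, j)
    · subst hk
      simp only [Function.update_self, mem_union] at hw
      rcases hw with hw | hw
      · exact (s.serves _ w hw).mono hA hB
      · rw [hNew, mem_sdiff, mem_inter, mem_nb] at hw
        exact ⟨r, FA, FB, hCp, hw.1.1.symm, fun u hu huw => hw.2 (mem_nbs.2 ⟨u, hu, huw.symm⟩),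
          hrCA, hFA, hFB, by simp, (subset_insert _ _).trans subset_union_right, subset_union_right⟩
    · simp only [Function.update_of_ne hk] at hw
      exact (s.serves k w hw).mono hA hB
  have hsub : ∀ k, Function.update s.Sv (e, j) (s.Sv (e, j) ∪ New) k ⊆ R.C k.2 := by
    intro k
    by_cases hk : k = (e, j)
    · subst hk
      simp only [Function.update_self, hNew]
      exact union_subset (s.Sv_sub _) (sdiff_subset.trans (inter_subset_right.trans sdiff_subset))
    · simpa [hk] using s.Sv_sub k
  have hMA : ∀ v ∈ s.MA ∪ insert r FA, ∃ h < S.K, v ∈ S.A h := by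
    intro v hv
    simp only [mem_union, mem_insert] at hv
    rcases hv with hv | rfl | hv
    · exact s.MA_mem v hv
    · exact ⟨_, (R.i_bounds e).2.trans_lt R.i_lt_K, hrA⟩
    · obtain ⟨h, h1, h2, h3⟩ := hFA v hv
      exact ⟨h, h2.trans R.i_lt_K, R.CA_sub h h1.le h2.le h3⟩
  have hMB : ∀ v ∈ s.MB ∪ FB, ∃ h < S.K, v ∈ S.B h := by
    intro v hv
    simp only [mem_union] at hv
    rcases hv with hv | hv
    · exact s.MB_mem v hv
    · obtain ⟨h, h1, h2, h3⟩ := hFB v hv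
      exact ⟨h, by omega, R.CB_sub h h1 h2 h3⟩
  have hMAn : #(nbs S.H (s.MA ∪ insert r FA) ∩ (R.C true ∪ R.C false)) ≤ 3 * (s.n + #New) := by
    have h1 : nbs S.H (s.MA ∪ insert r FA) ∩ (R.C true ∪ R.C false) ⊆
        (nbs S.H s.MA ∩ (R.C true ∪ R.C false)) ∪ ((nb S.H r ∩ U) ∪ (nbs S.H FA ∩ U)) := by
      intro v
      simp only [nbs_union, nbs_insert, mem_inter, mem_union, ← hU, State.U, mem_sdiff]
      tauto
    have h2 := (card_le_card h1).trans ((card_union_le _ _).trans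
      (Nat.add_le_add_left (card_union_le _ _) _))
    rw [hx] at h2
    have h3 := (Nat.cast_le (α := ℝ)).2 h2
    have h4 := (Nat.cast_le (α := ℝ)).2 s.MA_nbs
    rw [← State.n] at h4
    push_cast at h3 h4
    have h5 : (#(nbs S.H (s.MA ∪ insert r FA) ∩ (R.C true ∪ R.C false)) : ℝ) ≤
      3 * (s.n + #New) := by linarith
    exact_mod_cast h5
  have hMBn : (#(nbs S.H (s.MB ∪ FB) ∩ Γ) : ℝ) ≤
      2 ^ 13 * S.κ / R.ρ ^ 2 * (s.n + #New : ℕ) := by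
    have h1 : nbs S.H (s.MB ∪ FB) ∩ Γ ⊆ (nbs S.H s.MB ∩ Γ) ∪ (nbs S.H FB ∩ Γ) := by
      intro v; simp only [nbs_union, mem_inter, mem_union]; tauto
    have h2 := (Nat.cast_le (α := ℝ)).2 ((card_le_card h1).trans (card_union_le _ _))
    have h3 : 2 ^ 13 * S.κ / R.ρ ^ 2 * (x / 4) ≤ 2 ^ 13 * S.κ / R.ρ ^ 2 * #New := by
      gcongr; linarith
    have h4 := s.MB_nbs
    rw [← State.n] at h4
    push_cast at h2 ⊢
    linarith
  refine ⟨⟨Function.update s.Sv (e, j) (s.Sv (e, j) ∪ New), _, _, hsub, hserve, hMA, hMB, ?_, ?_⟩,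
    ?_, ?_⟩
  · rw [hsum]; exact hMAn
  · rw [hsum]; exact hMBn
  · have h2 : (0 : ℝ) < #New := by linarith
    have h3 : 0 < #New := by exact_mod_cast h2
    simp only [State.n, hsum]
    omega
  · simp only [State.n, hsum]; push_cast; linarith

/-- A light copy satisfies both hypotheses of `exists_extension`, because it has at most `τ`
vertices on each side and `τ * lam ≤ κ`. -/
theorem State.exists_next {R : S.Round} {d : ℕ} {Γ Y} (hL : R.Light d Γ Y)
    (hd : ∀ d' < d, ∀ Γ' Y', ¬ R.Light d' Γ' Y') (s : R.State (Γ true ∪ Γ false))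
    (hs : (s.n : ℝ) ≤ R.ρ * S.W / 8) :
    ∃ s' : R.State (Γ true ∪ Γ false), s.n < s'.n ∧ (s'.n : ℝ) ≤ s.n + S.κ * S.W := by
  obtain ⟨a, ha0, ⟨e, hae⟩, haZ⟩ := R.exists_typical_degree s hs
  have had := R.light_le s hs hd haZ
  have hκ0 := S.kappa_pos
  have hκ := S.kappa_le
  have hl := S.lam_pos
  have hτ := S.tau_lam
  have hρ := R.rho_pos
  have ha : (1 : ℝ) ≤ a := by exact_mod_cast ha0
  obtain ⟨j, r, FA, FB, hCp, hrCA, hra, hrj, hFA, hFB, hFAc, hFBc⟩ :=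
    R.exists_light_copy hL s hae haZ
  have hxa := (Nat.cast_le (α := ℝ)).2 hra
  refine s.exists_extension hCp hrCA
    (fun v hv => (hFA v hv).imp fun _ h => ⟨h.1, h.2.1, h.2.2.1⟩)
    (fun v hv => (hFB v hv).imp fun _ h => ⟨h.1, h.2.1, h.2.2.1⟩) (by omega) hrj ?_ ?_
  · calc (#(nbs S.H FA ∩ (s.U true ∪ s.U false)) : ℝ) ≤ #FA * (128 * S.lam * a) :=
          card_nbs_inter_le_mul fun v hv => (hFA v hv).elim fun _ h => h.2.2.2
      _ ≤ S.τ * (128 * S.lam * a) := by gcongr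
      _ = 128 * a * (S.τ * S.lam) := by ring
      _ ≤ 128 * a * (1 / 2 ^ 14) := by gcongr; linarith
      _ ≤ _ := by linarith
  -- Here `light_le` trades `d` for `a`: `ρ * d / 8 ≤ a` is at most the number of untouched
  -- neighbours of `r`. The constant `2 ^ 13` is `256 * 8 * 4`.
  · calc (#(nbs S.H FB ∩ (Γ true ∪ Γ false)) : ℝ) ≤ #FB * (256 * S.lam * d / R.ρ) :=
          card_nbs_inter_le_mul fun v hv => (hFB v hv).elim fun _ h => h.2.2.2
      _ ≤ S.τ * (256 * S.lam * d / R.ρ) := by gcongr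
      _ = 256 * d / R.ρ * (S.τ * S.lam) := by ring
      _ ≤ 256 * d / R.ρ * S.κ := by gcongr
      _ = 2 ^ 13 * S.κ / R.ρ ^ 2 * (R.ρ * d / 8 / 4) := by field_simp; ring
      _ ≤ _ := by gcongr; linarith

/-- The empty state. -/
def State.init (R : S.Round) (Γ : Finset V) : R.State Γ where
  Sv := fun _ => ∅
  MA := ∅
  MB := ∅
  Sv_sub := by simp
  serves := by simp
  MA_mem := by simp
  MB_mem := by simp
  MA_nbs := by simp [nbs]
  MB_nbs := by simp [nbs]

/-- One round: a positive proportion of the centres of one kind can be served by copies that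
together touch only a small part of every inner block. -/
theorem exists_serves : ∃ k : Bool × Bool, ∃ C' ⊆ R.C k.2, R.ρ * S.W / 32 ≤ #C' ∧
    ∃ MA MB, (∀ w ∈ C', R.Serves k MA MB w) ∧
      (∀ h, 0 < h → h < S.K - 1 → (#(nbs S.H MA ∩ S.B h) : ℝ) < S.lam * S.W) ∧
      (∀ h, R.i true < h → h < R.i false → (#(nbs S.H MB ∩ S.A h) : ℝ) < S.lam * S.W) := by
  classical
  obtain ⟨d, Γ, Y, hL, hd⟩ := R.exists_light
  have hW := S.W_pos
  have hκ0 := S.kappa_pos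
  have hκ := S.kappa_le
  have hκρ := R.kappa_le
  have hρ := R.rho_pos
  have hl := S.lam_le
  obtain ⟨s, hs1, hs2⟩ : ∃ s : R.State (Γ true ∪ Γ false), R.ρ * S.W / 8 < s.n ∧
      (s.n : ℝ) ≤ R.ρ * S.W / 8 + S.κ * S.W := by
    let p : ℕ → Prop := fun n => ∃ s : R.State (Γ true ∪ Γ false), s.n = n ∧
      (s.n : ℝ) ≤ R.ρ * S.W / 8 + S.κ * S.W
    have hp0 : p 0 := by
      refine ⟨State.init R _, by simp [State.n, State.init], ?_⟩
      simp [State.n, State.init]; positivity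
    let N := ⌊R.ρ * S.W / 8 + S.κ * S.W⌋₊
    -- A step raises `n` by at most `κ * W`, so the greatest `n` within the allowed range must have
    -- passed `ρ * W / 8`.
    obtain ⟨s, hsn, hs⟩ : p (Nat.findGreatest p N) := Nat.findGreatest_spec (Nat.zero_le _) hp0
    refine ⟨s, ?_, hs⟩
    by_contra! hc
    obtain ⟨s', h1, h2⟩ := s.exists_next hL hd hc
    have h3 : p s'.n := ⟨s', rfl, by linarith⟩
    have h4 : s'.n ≤ N := Nat.le_floor (by linarith)
    have := Nat.le_findGreatest h4 h3
    omega
  have hκ' : S.κ * S.W ≤ R.ρ / 2 ^ 14 * S.W := by gcongr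
  have hn : (s.n : ℝ) ≤ R.ρ * S.W / 7 := by nlinarith [mul_pos hρ hW]
  -- Pigeonhole over the four kinds turns `ρ * W / 8` into `ρ * W / 32`.
  obtain ⟨k, hk⟩ : ∃ k, (s.n : ℝ) / 4 ≤ #(s.Sv k) := by
    by_contra! h
    have : ∑ k, (#(s.Sv k) : ℝ) < ∑ _k : Bool × Bool, (s.n : ℝ) / 4 :=
      sum_lt_sum_of_nonempty univ_nonempty fun k _ => h k
    have h2 : ∑ k, (#(s.Sv k) : ℝ) = s.n := by simp [State.n]
    rw [h2] at this
    simp at this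
    linarith
  refine ⟨k, s.Sv k, s.Sv_sub k, by linarith, s.MA, s.MB, s.serves k, ?_, ?_⟩
  · intro h h1 h2
    -- At most `3 * n ≤ 3 * ρ * W / 7` centres are touched, so `MA` misses much of both outermost
    -- blocks and concavity bounds its reach in between.
    have hc : ∀ j, S.lam * S.W ≤ #(S.B (S.cen j) \ nbs S.H s.MA) := by
      intro j
      have h3 : (#(R.C j \ nbs S.H s.MA) : ℝ) + #(R.C j ∩ nbs S.H s.MA) = #(R.C j) := by
        exact_mod_cast card_sdiff_add_card_inter _ _
      have h4 : (#(R.C j ∩ nbs S.H s.MA) : ℝ) ≤ 3 * s.n := by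
        have h3 : R.C j ∩ nbs S.H s.MA ⊆ nbs S.H s.MA ∩ (R.C true ∪ R.C false) := by
          intro v; simp only [mem_inter, mem_union]; cases j <;> tauto
        exact_mod_cast (card_le_card h3).trans s.MA_nbs
      have h5 : (#(R.C j \ nbs S.H s.MA) : ℝ) ≤ #(S.B (S.cen j) \ nbs S.H s.MA) := by
        exact_mod_cast card_le_card (sdiff_subset_sdiff (R.C_sub j) subset_rfl)
      have h6 : S.lam * S.W ≤ S.κ * S.W := by gcongr
      nlinarith [R.C_card j, mul_pos hρ hW]
    exact S.conc_B _ s.MA_mem _ h _ (cen_true_lt h1) (lt_cen_false h2) (S.cen_lt false)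
      (hc true) (hc false)
  · intro h h1 h2
    -- The invariant `MB_nbs` and `κ ≤ ρ / 2 ^ 14` give at most `W / 14` reached vertices out of the
    -- `W / 4` or more in `Γ e`.
    have hc : ∀ e, S.lam * S.W ≤ #(S.A (R.i e) \ nbs S.H s.MB) := by
      intro e
      have h3 : (#(Γ e \ nbs S.H s.MB) : ℝ) + #(Γ e ∩ nbs S.H s.MB) = #(Γ e) := by
        exact_mod_cast card_sdiff_add_card_inter _ _
      have h4 : (#(Γ e ∩ nbs S.H s.MB) : ℝ) ≤ 2 ^ 13 * S.κ / R.ρ ^ 2 * s.n := by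
        refine le_trans ?_ s.MB_nbs
        have h3 : Γ e ∩ nbs S.H s.MB ⊆ nbs S.H s.MB ∩ (Γ true ∪ Γ false) := by
          intro v; simp only [mem_inter, mem_union]; cases e <;> tauto
        exact_mod_cast card_le_card h3
      have h5 : (#(Γ e \ nbs S.H s.MB) : ℝ) ≤ #(S.A (R.i e) \ nbs S.H s.MB) := by
        exact_mod_cast card_le_card (sdiff_subset_sdiff ((hL.1 e).1.trans
          (R.CA_sub _ (R.i_bounds e).1 (R.i_bounds e).2)) subset_rfl)
      have h6 : 2 ^ 13 * S.κ / R.ρ ^ 2 * s.n ≤ S.W / 8 := by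
        calc 2 ^ 13 * S.κ / R.ρ ^ 2 * s.n ≤
              2 ^ 13 * (R.ρ / 2 ^ 14) / R.ρ ^ 2 * (R.ρ * S.W / 7) := by gcongr
          _ = S.W / 14 := by field_simp; norm_num
          _ ≤ _ := by linarith
      have h7 : S.lam * S.W ≤ (1 / 2 ^ 14) * S.W := by gcongr; linarith
      linarith [(hL.1 e).2]
    exact S.conc_A _ s.MB_mem _ h _ h1 h2 R.i_lt_K (hc true) (hc false)

end Round

end Host

/-! ### Targets, and the state between rounds. -/

section Copies

variable {U V : Type*} [DecidableEq U] [Fintype V] [DecidableEq V]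

/-- `φ` is a copy of the part of `T` on `D` whose vertices lie in the prescribed sets. -/
structure IsCopy (T : Bigraph U) (S : Host V) (X Y : ℕ → Finset V) (D : Finset U) (pos : U → ℕ)
    (φ : U → V) : Prop where
  mem₁ : ∀ u ∈ D, u ∈ T.V₁ → φ u ∈ X (pos u)
  mem₂ : ∀ u ∈ D, u ∈ T.V₂ → φ u ∈ Y (pos u)
  adj : ∀ u ∈ D, u ∈ T.V₁ → ∀ v ∈ D, v ∈ T.V₂ → (T.graph.Adj u v ↔ S.H.Adj (φ u) (φ v))

/-- `a` lies strictly on the outer side of `b`, at the beginning or at the end. -/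
def Outside (e : Bool) (a b : ℕ) : Prop := if e then a < b else b < a

/-- Assignment of distinct blocks to the vertices of `D`. -/
structure IsPlacement (T : Bigraph U) (K : ℕ) (D : Finset U) (pos : U → ℕ) : Prop where
  lt : ∀ u ∈ D, pos u < K
  inj₁ : ∀ u ∈ D, u ∈ T.V₁ → ∀ v ∈ D, v ∈ T.V₁ → pos u = pos v → u = v
  inj₂ : ∀ u ∈ D, u ∈ T.V₂ → ∀ v ∈ D, v ∈ T.V₂ → pos u = pos v → u = v

/-- There is a rainbow copy of `T[D]` in which `r` comes first (or last) on its side. -/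
def Realized (T : Bigraph U) (S : Host V) (e : Bool) (D : Finset U) (r : U) : Prop :=
  ∃ pos φ, IsPlacement T S.K D pos ∧ IsCopy T S S.A S.B D pos φ ∧
    ∀ u ∈ D, u ∈ T.V₁ → u ≠ r → Outside e (pos r) (pos u)

/-- The `l`-th block among `A` from the beginning, or from the end. -/
def Host.fin (S : Host V) (e : Bool) (l : ℕ) : ℕ := if e then l else S.K - 1 - l

/-- A vertex `x` with rooted trees hanging from it, each of which can be found with its root in
one of the first (last) blocks and the remaining vertices in prescribed blocks. -/
structure Target (T : Bigraph U) (S : Host V) (δ : ℕ) (e : Bool) where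
  x : U
  m : ℕ
  comp : ℕ → Finset U
  y : ℕ → U
  pos : U → ℕ
  m_pos : 0 < m
  m_le : m ≤ δ + 1
  x_mem : x ∈ T.V₂
  y_mem : ∀ i < m, y i ∈ comp i
  y_mem₁ : ∀ i < m, y i ∈ T.V₁
  x_notMem : ∀ i < m, x ∉ comp i
  disjoint : ∀ i < m, ∀ j < m, i ≠ j → Disjoint (comp i) (comp j)
  not_adj : ∀ i < m, ∀ j < m, i ≠ j → ∀ u ∈ comp i, ∀ v ∈ comp j, ¬ T.graph.Adj u v
  adj_x : ∀ i < m, ∀ u ∈ comp i, (T.graph.Adj x u ↔ u = y i)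
  card_le : ∀ i < m, #(comp i) ≤ S.τ
  pos₁ : ∀ i < m, ∀ u ∈ comp i, u ∈ T.V₁ → 4 * δ < pos u ∧ pos u + 4 * δ < S.K - 1
  pos₂ : ∀ i < m, ∀ u ∈ comp i, u ∈ T.V₂ → 0 < pos u ∧ pos u < S.K - 1
  inj₁ : ∀ i < m, ∀ u ∈ comp i, u ∈ T.V₁ → ∀ j < m, ∀ v ∈ comp j, v ∈ T.V₁ → pos u = pos v → u = v
  inj₂ : ∀ i < m, ∀ u ∈ comp i, u ∈ T.V₂ → ∀ j < m, ∀ v ∈ comp j, v ∈ T.V₂ → pos u = pos v → u = v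
  copies : ∀ i < m, ∀ l ≤ 4 * δ, ∀ X Y : ℕ → Finset V,
    (∀ h < S.K, X h ⊆ S.A h ∧ S.κ * S.W ≤ #(X h)) →
    (∀ h < S.K, Y h ⊆ S.B h ∧ S.κ * S.W ≤ #(Y h)) →
    ∃ φ, IsCopy T S X Y (comp i) (Function.update pos (y i) (S.fin e l)) φ

variable {T : Bigraph U} {S : Host V} {δ : ℕ}

/-- The vertices of the first `n` trees. -/
noncomputable def Target.att {e} (t : Target T S δ e) (n : ℕ) : Finset U :=
  (range n).biUnion t.comp

theorem Target.mem_att {e} {t : Target T S δ e} {n : ℕ} {u : U} :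
    u ∈ t.att n ↔ ∃ i < n, u ∈ t.comp i := by simp [att]

/-- The target with its centre. -/
noncomputable def Target.D {e} (t : Target T S δ e) : Finset U :=
  insert t.x (t.att t.m)

/-- The state after `l` rounds of attaching trees to centres. -/
structure Attached (tg : ∀ e, Target T S δ e) (l : ℕ) where
  n : Bool × Bool → ℕ
  p : Bool × Bool → U → ℕ
  C : Bool → Finset V
  CA : ℕ → Finset V
  CB : ℕ → Finset V
  n_le : ∀ k, n k ≤ (tg k.1).m
  n_sum : ∑ k, n k = l
  p_eq : ∀ k u, (∀ i < n k, u ≠ (tg k.1).y i) → p k u = (tg k.1).pos u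
  p_fin : ∀ k, ∀ i < n k, ∃ l' < l, p k ((tg k.1).y i) = S.fin k.1 l'
  p_out : ∀ k, ∀ i' < n k, ∀ i < i', Outside k.1 (p k ((tg k.1).y i)) (p k ((tg k.1).y i'))
  C_sub : ∀ j, C j ⊆ S.B (S.cen j)
  C_card : ∀ j, (1 / 2 ^ (5 * l)) * S.W ≤ #(C j)
  CA_sub : ∀ h, l ≤ h → h ≤ S.K - 1 - l → CA h ⊆ S.A h
  CA_card : ∀ h, l ≤ h → h ≤ S.K - 1 - l → (1 - l * S.lam) * S.W ≤ #(CA h)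
  CB_sub : ∀ h, 0 < h → h < S.K - 1 → CB h ⊆ S.B h
  CB_card : ∀ h, 0 < h → h < S.K - 1 → (1 - l * S.lam) * S.W ≤ #(CB h)
  att : ∀ k, ∀ w ∈ C k.2, ∃ ψ, IsCopy T S S.A S.B ((tg k.1).att (n k)) (p k) ψ ∧
    (∀ u ∈ (tg k.1).att (n k), u ∈ T.V₁ → (S.H.Adj w (ψ u) ↔ ∃ i < n k, u = (tg k.1).y i)) ∧
    (∀ u ∈ (tg k.1).att (n k), u ∈ T.V₁ →
      ∀ h, 0 < h → h < S.K - 1 → ∀ v ∈ CB h, ¬ S.H.Adj (ψ u) v) ∧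
    (∀ u ∈ (tg k.1).att (n k), u ∈ T.V₂ →
      ∀ h, l ≤ h → h ≤ S.K - 1 - l → ∀ v ∈ CA h, ¬ S.H.Adj (ψ u) v)

namespace Attached

variable {tg : ∀ e, Target T S δ e} {l : ℕ}

/-- The state before the first round. -/
def init (tg : ∀ e, Target T S δ e) : Attached tg 0 where
  n := fun _ => 0
  p := fun k => (tg k.1).pos
  C := fun j => S.B (S.cen j)
  CA := S.A
  CB := S.B
  n_le := by simp
  n_sum := by simp
  p_eq := by simp
  p_fin := by simp
  p_out := by simp
  C_sub := by simp
  C_card := fun j => by simp [S.card_B _ (S.cen_lt j)]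
  CA_sub := by simp
  CA_card := fun h _ h2 => by
    have := S.one_lt_K
    simp [S.card_A h (by omega)]
  CB_sub := by simp
  CB_card := fun h _ h2 => by simp [S.card_B h (by omega)]
  att := fun k w _ => by
    have : Nonempty V := ⟨w⟩
    refine ⟨fun _ => w, ⟨?_, ?_, ?_⟩, ?_⟩ <;> simp [Target.att]

/-- When all trees have been attached to centres of one kind, the target is realized. -/
theorem realized (s : Attached tg l) (hK : 8 * δ + 2 ≤ S.K) (hl : l ≤ 4 * δ + 1) {k : Bool × Bool}
    (hk : s.n k = (tg k.1).m) : Realized T S k.1 (tg k.1).D ((tg k.1).y 0) := by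
  classical
  set t := tg k.1 with ht
  have hC : (0 : ℝ) < #(s.C k.2) := lt_of_lt_of_le (by have := S.W_pos; positivity) (s.C_card k.2)
  obtain ⟨w, hw⟩ : (s.C k.2).Nonempty := card_pos.1 (by exact_mod_cast hC)
  obtain ⟨ψ, hψ, hψw, -, -⟩ := s.att k w hw
  rw [hk, ← ht] at hψ hψw
  have hD : ∀ u, u ∈ t.D ↔ u = t.x ∨ ∃ i < t.m, u ∈ t.comp i := by
    intro u; simp [Target.D, Target.mem_att]
  have hx1 : t.x ∉ T.V₁ := fun h => T.disj _ h t.x_mem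
  have hxa : ∀ u, (∃ i < t.m, u ∈ t.comp i) → u ≠ t.x := by
    rintro u ⟨i, hi, hu⟩ rfl
    exact t.x_notMem i hi hu
  have h2eq : ∀ u ∈ T.V₂, s.p k u = t.pos u := fun u hu => s.p_eq k u fun i hi he =>
    T.disj _ (t.y_mem₁ i (hk ▸ hi)) (he ▸ hu)
  have hcase : ∀ u, (∃ i < t.m, u ∈ t.comp i) → u ∈ T.V₁ → (∃ i < t.m, u = t.y i) ∨
      (s.p k u = t.pos u ∧ ∀ i < t.m, u ≠ t.y i) := by
    intro u _ _
    by_cases h : ∃ i < t.m, u = t.y i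
    · exact Or.inl h
    · push Not at h
      exact Or.inr ⟨s.p_eq k u fun i hi => h i (hk ▸ hi), h⟩
  -- The roots occupy the `4 * δ + 1` outermost blocks, which `pos₁` keeps free of all other
  -- vertices; they are ordered inward by time of attachment, so `y 0` is extreme.
  have hfin : ∀ i < t.m, s.p k (t.y i) ≤ 4 * δ ∧ k.1 = true ∨
      S.K - 1 ≤ s.p k (t.y i) + 4 * δ ∧ s.p k (t.y i) < S.K ∧ k.1 = false := by
    intro i hi
    obtain ⟨l', hl', h⟩ := s.p_fin k i (hk ▸ hi)
    rw [← ht] at h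
    rw [h]
    unfold Host.fin
    cases k.1 <;> simp <;> omega
  have hout : ∀ i < t.m, ∀ u, (∃ i < t.m, u ∈ t.comp i) → u ∈ T.V₁ → (∀ i < t.m, u ≠ t.y i) →
      Outside k.1 (s.p k (t.y i)) (s.p k u) := by
    intro i hi u hu hu1 hne
    rcases hcase u hu hu1 with ⟨j, hj, h⟩ | ⟨h, -⟩
    · exact absurd h (hne j hj)
    · obtain ⟨j, hj, huj⟩ := hu
      have h1 := t.pos₁ j hj u huj hu1
      have h2 := hfin i hi
      rw [h]
      unfold Outside
      rcases h2 with ⟨h2, h3⟩ | ⟨h2, -, h3⟩ <;> simp [h3] <;> omega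
  have hout2 : ∀ i' < t.m, ∀ i < i', Outside k.1 (s.p k (t.y i)) (s.p k (t.y i')) := by
    intro i' hi' i hi
    exact s.p_out k i' (hk ▸ hi') i hi
  have hirr : ∀ a b, Outside k.1 a b → a ≠ b := by
    intro a b; unfold Outside; split <;> omega
  have hp1 : ∀ u ∈ t.D, u ∈ T.V₁ → ∃ i < t.m, u ∈ t.comp i := by
    intro u hu hu1
    rcases (hD u).1 hu with rfl | h
    exacts [absurd hu1 hx1, h]
  have hcen : S.cen k.2 = 0 ∨ S.cen k.2 = S.K - 1 := by unfold Host.cen; split <;> simp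
  refine ⟨Function.update (s.p k) t.x (S.cen k.2), Function.update ψ t.x w, ⟨?_, ?_, ?_⟩,
    ⟨?_, ?_, ?_⟩, ?_⟩
  · intro u hu
    rcases (hD u).1 hu with rfl | h
    · simpa using S.cen_lt k.2
    · rw [Function.update_of_ne (hxa u h)]
      obtain ⟨j, hj, huj⟩ := id h
      rcases T.cover u with hu1 | hu2
      · rcases hcase u h hu1 with ⟨i, hi, rfl⟩ | ⟨h1, -⟩
        · rcases hfin i hi with ⟨h2, -⟩ | ⟨-, h2, -⟩ <;> omega
        · rw [h1]
          have := t.pos₁ j hj u huj hu1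
          omega
      · rw [h2eq u hu2]
        have := t.pos₂ j hj u huj hu2
        omega
  · intro u hu hu1 v hv hv1 huv
    have hu' := hp1 u hu hu1
    have hv' := hp1 v hv hv1
    rw [Function.update_of_ne (hxa u hu'), Function.update_of_ne (hxa v hv')] at huv
    rcases hcase u hu' hu1 with ⟨i, hi, rfl⟩ | ⟨h1, h1'⟩ <;>
      rcases hcase v hv' hv1 with ⟨j, hj, rfl⟩ | ⟨h2, h2'⟩
    · rcases lt_trichotomy i j with h | rfl | h
      · exact absurd huv (hirr _ _ (hout2 j hj i h))
      · rfl
      · exact absurd huv.symm (hirr _ _ (hout2 i hi j h))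
    · exact absurd huv (hirr _ _ (hout i hi v hv' hv1 h2'))
    · exact absurd huv.symm (hirr _ _ (hout j hj u hu' hu1 h1'))
    · obtain ⟨i, hi, hui⟩ := hu'
      obtain ⟨j, hj, hvj⟩ := hv'
      exact t.inj₁ i hi u hui hu1 j hj v hvj hv1 (by rw [← h1, ← h2, huv])
  · intro u hu hu2 v hv hv2 huv
    rcases (hD u).1 hu with rfl | hu' <;> rcases (hD v).1 hv with rfl | hv'
    · rfl
    · rw [Function.update_self, Function.update_of_ne (hxa v hv'), h2eq v hv2] at huv
      obtain ⟨j, hj, hvj⟩ := hv'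
      have := t.pos₂ j hj v hvj hv2
      omega
    · rw [Function.update_self, Function.update_of_ne (hxa u hu'), h2eq u hu2] at huv
      obtain ⟨j, hj, huj⟩ := hu'
      have := t.pos₂ j hj u huj hu2
      omega
    · rw [Function.update_of_ne (hxa u hu'), Function.update_of_ne (hxa v hv'), h2eq v hv2,
        h2eq u hu2] at huv
      obtain ⟨i, hi, hui⟩ := hu'
      obtain ⟨j, hj, hvj⟩ := hv'
      exact t.inj₂ i hi u hui hu2 j hj v hvj hv2 huv
  · intro u hu hu1
    have hu' := hp1 u hu hu1
    rw [Function.update_of_ne (hxa u hu'), Function.update_of_ne (hxa u hu')]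
    exact hψ.mem₁ u (Target.mem_att.2 hu') hu1
  · intro u hu hu2
    rcases (hD u).1 hu with rfl | hu'
    · simpa using s.C_sub k.2 hw
    · rw [Function.update_of_ne (hxa u hu'), Function.update_of_ne (hxa u hu')]
      exact hψ.mem₂ u (Target.mem_att.2 hu') hu2
  · intro u hu hu1 v hv hv2
    have hu' := hp1 u hu hu1
    rw [Function.update_of_ne (hxa u hu')]
    rcases (hD v).1 hv with rfl | hv'
    · rw [Function.update_self, S.H.adj_comm, hψw u (Target.mem_att.2 hu') hu1, T.graph.adj_comm]
      obtain ⟨i, hi, hui⟩ := hu'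
      rw [t.adj_x i hi u hui]
      refine ⟨fun h => ⟨i, hi, h⟩, ?_⟩
      rintro ⟨j, hj, rfl⟩
      by_contra hne
      have hij : i ≠ j := fun h => hne (h ▸ rfl)
      exact disjoint_left.1 (t.disjoint i hi j hj hij) hui (t.y_mem j hj)
    · rw [Function.update_of_ne (hxa v hv')]
      exact hψ.adj u (Target.mem_att.2 hu') hu1 v (Target.mem_att.2 hv') hv2
  · intro u hu hu1 hne
    have hu' := hp1 u hu hu1
    have h0 : t.y 0 ≠ t.x := hxa _ ⟨0, t.m_pos, t.y_mem 0 t.m_pos⟩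
    rw [Function.update_of_ne h0, Function.update_of_ne (hxa u hu')]
    rcases hcase u hu' hu1 with ⟨i, hi, rfl⟩ | ⟨h1, h1'⟩
    · exact hout2 i hi 0 (Nat.pos_of_ne_zero fun h => hne (h ▸ rfl))
    · exact hout 0 t.m_pos u hu' hu1 h1'

end Attached

end Copies

/-! ### Iterating the rounds. -/

section Copies

variable {U V : Type*} [DecidableEq U] [Fintype V] [DecidableEq V]

variable {T : Bigraph U} {S : Host V} {δ : ℕ}

omit [DecidableEq U] in
theorem IsCopy.mono {X Y X' Y' : ℕ → Finset V} {D : Finset U} {pos : U → ℕ} {φ : U → V}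
    (h : IsCopy T S X Y D pos φ) (hX : ∀ u ∈ D, u ∈ T.V₁ → X (pos u) ⊆ X' (pos u))
    (hY : ∀ u ∈ D, u ∈ T.V₂ → Y (pos u) ⊆ Y' (pos u)) : IsCopy T S X' Y' D pos φ :=
  ⟨fun u hu h1 => hX u hu h1 (h.mem₁ u hu h1), fun u hu h2 => hY u hu h2 (h.mem₂ u hu h2), h.adj⟩

namespace Attached

variable {tg : ∀ e, Target T S δ e} {l : ℕ}

/-- The copies of the next tree to be attached at a centre of kind `k`. -/
noncomputable def Cp (s : Attached tg l) (k : Bool × Bool) (r : V) (FA FB : Finset V) : Prop :=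
  ∃ φ : U → V, IsCopy T S S.A S.B ((tg k.1).comp (s.n k))
      (Function.update (tg k.1).pos ((tg k.1).y (s.n k)) (S.fin k.1 l)) φ ∧
    r = φ ((tg k.1).y (s.n k)) ∧
    FA = {u ∈ (tg k.1).comp (s.n k) | u ∈ T.V₁ ∧ u ≠ (tg k.1).y (s.n k)}.image φ ∧
    FB = {u ∈ (tg k.1).comp (s.n k) | u ∈ T.V₂}.image φ

/-- The data of the next round. -/
noncomputable def round (s : Attached tg l) (hl : l ≤ 4 * δ) (hn : ∀ k, s.n k < (tg k.1).m)
    (hK : 8 * δ + 4 ≤ S.K) (hκ : S.κ ≤ 1 / 2 ^ (20 * δ + 14))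
    (hlam : (4 * δ + 1) * S.lam ≤ 1 / 4) : S.Round where
  i := fun e => S.fin e l
  C := s.C
  CA := s.CA
  CB := s.CB
  ρ := 1 / 2 ^ (5 * l)
  Cp := s.Cp
  i_lt := by simp [Host.fin]; omega
  i_lt_K := by simp [Host.fin]; omega
  rho_pos := by positivity
  rho_le := by
    rw [div_le_one (by positivity)]
    exact one_le_pow₀ (by norm_num)
  kappa_le := by
    -- Since `l ≤ 4 * δ`, the exponent `5 * l + 14` never exceeds `20 * δ + 14`.
    refine hκ.trans ?_
    rw [div_div, ← pow_add]
    exact one_div_le_one_div_of_le (by positivity) (pow_le_pow_right₀ (by norm_num) (by omega))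
  C_sub := s.C_sub
  C_card := s.C_card
  CA_sub := fun h h1 h2 => s.CA_sub h (by simpa [Host.fin] using h1) (by simpa [Host.fin] using h2)
  CA_card := fun h h1 h2 => by
    refine le_trans ?_ (s.CA_card h (by simpa [Host.fin] using h1) (by simpa [Host.fin] using h2))
    have := S.W_pos
    have := S.lam_pos
    have : (l : ℝ) * S.lam ≤ (4 * δ + 1) * S.lam := by
      gcongr
      exact_mod_cast hl.trans (Nat.le_succ _)
    gcongr
    linarith
  CB_sub := s.CB_sub
  CB_card := fun h h1 h2 => by
    refine le_trans ?_ (s.CB_card h h1 h2)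
    have := S.W_pos
    have := S.lam_pos
    have : (l : ℝ) * S.lam ≤ (4 * δ + 1) * S.lam := by
      gcongr
      exact_mod_cast hl.trans (Nat.le_succ _)
    gcongr
    linarith
  copies := by
    intro k X Y hX hY
    have hκ1 := S.kappa_le
    have hW := S.W_pos
    have hκW : S.κ * S.W ≤ S.W := by nlinarith
    set t := tg k.1 with ht
    -- The target asks for a set in every block; blocks outside the range of this round are filled
    -- in whole and are not used.
    obtain ⟨φ, hφ⟩ := t.copies (s.n k) (hn k) l hl
      (fun h => if S.fin true l ≤ h ∧ h ≤ S.fin false l then X h else S.A h)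
      (fun h => if 0 < h ∧ h < S.K - 1 then Y h else S.B h)
      (by
        intro h hh
        split_ifs with h1
        · exact hX h h1.1 h1.2
        · exact ⟨subset_rfl, by rw [S.card_A h hh]; exact hκW⟩)
      (by
        intro h hh
        split_ifs with h1
        · exact hY h h1.1 h1.2
        · exact ⟨subset_rfl, by rw [S.card_B h hh]; exact hκW⟩)
    have hfin : S.fin true l ≤ S.fin k.1 l ∧ S.fin k.1 l ≤ S.fin false l := by
      cases k.1 <;> simp [Host.fin] <;> omega
    have hy := t.y_mem _ (hn k)
    have hy1 := t.y_mem₁ _ (hn k)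
    have hne2 : ∀ u ∈ T.V₂, u ≠ t.y (s.n k) := fun u hu h => T.disj _ hy1 (h ▸ hu)
    refine ⟨φ (t.y (s.n k)), _, _, ⟨φ, ?_, rfl, rfl, rfl⟩, ?_, ?_, ?_, ?_, ?_⟩
    · refine hφ.mono (fun u _ _ => ?_) (fun u _ _ => ?_)
      · split_ifs with h1
        exacts [(hX _ h1.1 h1.2).1, subset_rfl]
      · split_ifs with h1
        exacts [(hY _ h1.1 h1.2).1, subset_rfl]
    · have := hφ.mem₁ _ hy hy1
      rw [Function.update_self, if_pos hfin] at this
      exact this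
    · intro v hv
      simp only [mem_image, mem_filter] at hv
      obtain ⟨u, ⟨hu, hu1, hne⟩, rfl⟩ := hv
      have h1 := hφ.mem₁ u hu hu1
      have h2 := t.pos₁ _ (hn k) u hu hu1
      rw [Function.update_of_ne hne] at h1
      refine ⟨t.pos u, by simp [Host.fin]; omega, by simp [Host.fin]; omega, ?_⟩
      rwa [if_pos (by simp [Host.fin]; omega)] at h1
    · intro v hv
      simp only [mem_image, mem_filter] at hv
      obtain ⟨u, ⟨hu, hu2⟩, rfl⟩ := hv
      have h1 := hφ.mem₂ u hu hu2
      have h2 := t.pos₂ _ (hn k) u hu hu2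
      rw [Function.update_of_ne (hne2 u hu2), if_pos h2] at h1
      exact ⟨t.pos u, h2.1, h2.2, h1⟩
    · exact card_image_le.trans ((card_filter_le _ _).trans (t.card_le _ (hn k)))
    · exact card_image_le.trans ((card_filter_le _ _).trans (t.card_le _ (hn k)))

theorem card_sdiff_nbs {X Y M : Finset V} {l : ℕ} {lam W : ℝ} (hXY : X ⊆ Y)
    (h1 : (1 - l * lam) * W ≤ #X) (h2 : (#(nbs S.H M ∩ Y) : ℝ) < lam * W) :
    (1 - (l + 1 : ℕ) * lam) * W ≤ #(X \ nbs S.H M) := by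
  have h3 : (#(X \ nbs S.H M) : ℝ) + #(X ∩ nbs S.H M) = #X := by
    exact_mod_cast card_sdiff_add_card_inter _ _
  have h4 : (#(X ∩ nbs S.H M) : ℝ) ≤ #(nbs S.H M ∩ Y) := by
    rw [inter_comm]; exact_mod_cast card_le_card (inter_subset_inter_left hXY)
  push_cast
  linarith

/-- For the kind chosen by `exists_serves`, every surviving centre gets its own copy of the next
branch. Removing the neighbours of `MA` and `MB` from the inner blocks keeps future copies free of
edges to these, at a cost of less than `lam * W` per block. Centres of the other position and their
attached trees stay as they are. -/
theorem exists_next (s : Attached tg l) (hl : l ≤ 4 * δ) (hn : ∀ k, s.n k < (tg k.1).m)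
    (hK : 8 * δ + 4 ≤ S.K) (hκ : S.κ ≤ 1 / 2 ^ (20 * δ + 14))
    (hlam : (4 * δ + 1) * S.lam ≤ 1 / 4) : Nonempty (Attached tg (l + 1)) := by
  classical
  have hW := S.W_pos
  obtain ⟨k, C', hC'sub, hC'card, MA, MB, hserve, hMA, hMB⟩ :=
    (s.round hl hn hK hκ hlam).exists_serves
  have hserve' : ∀ w ∈ C', ∃ r FA FB, s.Cp k r FA FB ∧ S.H.Adj w r ∧ (∀ u ∈ FA, ¬ S.H.Adj w u) ∧
    r ∈ s.CA (S.fin k.1 l) ∧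
    (∀ v ∈ FA, ∃ h, S.fin true l < h ∧ h < S.fin false l ∧ v ∈ s.CA h) ∧
    (∀ v ∈ FB, ∃ h, 0 < h ∧ h < S.K - 1 ∧ v ∈ s.CB h) ∧ r ∈ MA ∧ FA ⊆ MA ∧ FB ⊆ MB := hserve
  clear hserve
  replace hC'sub : C' ⊆ s.C k.2 := hC'sub
  replace hC'card : 1 / 2 ^ (5 * l) * S.W / 32 ≤ (#C' : ℝ) := hC'card
  have hfinT : S.fin true l = l := rfl
  have hfinF : S.fin false l = S.K - 1 - l := rfl
  replace hMB : ∀ h, S.fin true l < h → h < S.fin false l →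
    (#(nbs S.H MB ∩ S.A h) : ℝ) < S.lam * S.W := hMB
  rw [hfinT, hfinF] at hMB
  rw [hfinT, hfinF] at hserve'
  set t := tg k.1 with ht
  set N := s.n k with hN
  have hNm : N < t.m := hn k
  have hy := t.y_mem _ hNm
  have hy1 := t.y_mem₁ _ hNm
  have hyne : ∀ i < N, t.y i ≠ t.y N := by
    intro i hi h
    exact disjoint_left.1 (t.disjoint i (hi.trans hNm) N hNm hi.ne) (t.y_mem i (hi.trans hNm))
      (h ▸ hy)
  have hynot : ∀ i < N, t.y N ∉ t.comp i := fun i hi h =>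
    disjoint_left.1 (t.disjoint i (hi.trans hNm) N hNm hi.ne) h hy
  have hnotN : ∀ u, (∃ i < N, u ∈ t.comp i) → u ∉ t.comp N := by
    rintro u ⟨i, hi, hu⟩ h
    exact disjoint_left.1 (t.disjoint i (hi.trans hNm) N hNm hi.ne) hu h
  have hfin_out : ∀ i < N, Outside k.1 (s.p k (t.y i)) (S.fin k.1 l) := by
    intro i hi
    obtain ⟨l', hl', h⟩ := s.p_fin k i hi
    rw [← ht] at h
    rw [h]
    unfold Outside Host.fin
    cases k.1 <;> simp <;> omega
  have hCsub : ∀ j, Function.update s.C k.2 C' j ⊆ s.C j := by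
    intro j
    by_cases hj : j = k.2
    · subst hj; simpa using hC'sub
    · simp [hj]
  have hattN : t.att (N + 1) = t.att N ∪ t.comp N := by
    ext u
    simp only [Target.mem_att, mem_union, Nat.lt_succ_iff_lt_or_eq]
    constructor
    · rintro ⟨i, hi | rfl, hu⟩
      exacts [Or.inl ⟨i, hi, hu⟩, Or.inr hu]
    · rintro (⟨i, hi, hu⟩ | hu)
      exacts [⟨i, Or.inl hi, hu⟩, ⟨N, Or.inr rfl, hu⟩]
  refine ⟨{
    n := Function.update s.n k (N + 1)
    p := Function.update s.p k (Function.update (s.p k) (t.y N) (S.fin k.1 l))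
    C := Function.update s.C k.2 C'
    CA := fun h => s.CA h \ nbs S.H MB
    CB := fun h => s.CB h \ nbs S.H MA
    n_le := ?_
    n_sum := ?_
    p_eq := ?_
    p_fin := ?_
    p_out := ?_
    C_sub := fun j => (hCsub j).trans (s.C_sub j)
    C_card := ?_
    CA_sub := fun h h1 h2 => sdiff_subset.trans (s.CA_sub h (by omega) (by omega))
    CA_card := fun h h1 h2 => card_sdiff_nbs (s.CA_sub h (by omega) (by omega))
      (s.CA_card h (by omega) (by omega)) (hMB h (by omega) (by omega))
    CB_sub := fun h h1 h2 => sdiff_subset.trans (s.CB_sub h h1 h2)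
    CB_card := fun h h1 h2 => card_sdiff_nbs (s.CB_sub h h1 h2) (s.CB_card h h1 h2) (hMA h h1 h2)
    att := ?_ }⟩
  · intro k'
    by_cases hk : k' = k
    · subst hk; simpa using hNm
    · simpa [hk] using s.n_le k'
  · rw [sum_update_of_mem (mem_univ _), sdiff_singleton_eq_erase]
    have := s.n_sum
    rw [← add_sum_erase univ _ (mem_univ k)] at this
    omega
  · intro k' u hu
    by_cases hk : k' = k
    · subst hk
      simp only [Function.update_self] at hu ⊢
      rw [Function.update_of_ne (hu N (by omega))]
      exact s.p_eq _ u fun i hi => hu i (by omega)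
    · simp only [Function.update_of_ne hk] at hu ⊢
      exact s.p_eq k' u hu
  · intro k' i hi
    by_cases hk : k' = k
    · subst hk
      simp only [Function.update_self] at hi ⊢
      rcases Nat.lt_succ_iff_lt_or_eq.1 hi with hi | rfl
      · rw [Function.update_of_ne (hyne i hi)]
        obtain ⟨l', hl', h⟩ := s.p_fin _ i hi
        exact ⟨l', by omega, h⟩
      · exact ⟨l, by omega, by rw [Function.update_self]⟩
    · simp only [Function.update_of_ne hk] at hi ⊢
      obtain ⟨l', hl', h⟩ := s.p_fin _ i hi
      exact ⟨l', by omega, h⟩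
  · intro k' i' hi' i hi
    by_cases hk : k' = k
    · subst hk
      simp only [Function.update_self] at hi' ⊢
      rcases Nat.lt_succ_iff_lt_or_eq.1 hi' with hi' | rfl
      · rw [Function.update_of_ne (hyne i (hi.trans hi')), Function.update_of_ne (hyne i' hi')]
        exact s.p_out _ i' hi' i hi
      · rw [Function.update_of_ne (hyne i hi), Function.update_self]
        exact hfin_out i hi
    · simp only [Function.update_of_ne hk] at hi' ⊢
      exact s.p_out _ i' hi' i hi
  · intro j
    -- The factor `2 ^ 5` per round is the 32 of `exists_serves`.
    have h1 : (1 / 2 ^ (5 * (l + 1))) * S.W = 1 / 2 ^ (5 * l) * S.W / 32 := by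
      rw [mul_add, pow_add]; ring
    rw [h1]
    by_cases hj : j = k.2
    · subst hj; simpa using hC'card
    · rw [Function.update_of_ne hj]
      have h2 : (0 : ℝ) ≤ 1 / 2 ^ (5 * l) * S.W := by positivity
      linarith [s.C_card j]
  · intro k' w hw
    obtain ⟨ψ, hψ, hψw, hψA, hψB⟩ := s.att k' w (hCsub _ hw)
    by_cases hk : k' = k
    swap
    · simp only [Function.update_of_ne hk]
      refine ⟨ψ, hψ, hψw, ?_, ?_⟩
      · intro u hu hu1 h h1 h2 v hv
        exact hψA u hu hu1 h h1 h2 v (sdiff_subset hv)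
      · intro u hu hu2 h h1 h2 v hv
        exact hψB u hu hu2 h (by omega) (by omega) v (sdiff_subset hv)
    · subst hk
      simp only [Function.update_self] at hw ⊢
      obtain ⟨r, FA, FB, ⟨φ, hφ, rfl, hFA, hFB⟩, hwr, hwF, hrA, hFAm, hFBm, hrM, hFAM, hFBM⟩ :=
        hserve' w hw
      rw [← ht, ← hN] at hψ hψw hψA hψB hφ hFA hFB hwr hrA hrM
      have hmF : ∀ u ∈ t.comp N, u ∈ T.V₁ → u ≠ t.y N → φ u ∈ FA := by
        intro u hu hu1 hne
        rw [hFA]; exact mem_image_of_mem _ (by simp [hu, hu1, hne])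
      have hmB : ∀ u ∈ t.comp N, u ∈ T.V₂ → φ u ∈ FB := by
        intro u hu hu2
        rw [hFB]; exact mem_image_of_mem _ (by simp [hu, hu2])
      have hmMA : ∀ u ∈ t.comp N, u ∈ T.V₁ → φ u ∈ MA := by
        intro u hu hu1
        by_cases hne : u = t.y N
        · rw [hne]; exact hrM
        · exact hFAM (hmF u hu hu1 hne)
      have hmMB : ∀ u ∈ t.comp N, u ∈ T.V₂ → φ u ∈ MB := fun u hu hu2 => hFBM (hmB u hu hu2)
      have hmCA : ∀ u ∈ t.comp N, u ∈ T.V₁ → ∃ h, l ≤ h ∧ h ≤ S.K - 1 - l ∧ φ u ∈ s.CA h := by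
        intro u hu hu1
        by_cases hne : u = t.y N
        · rw [hne]
          refine ⟨_, ?_, ?_, hrA⟩ <;> unfold Host.fin <;> split <;> omega
        · obtain ⟨h, h1, h2, h3⟩ := hFAm _ (hmF u hu hu1 hne)
          exact ⟨h, h1.le, h2.le, h3⟩
      -- Glue the new copy to the old ones. Cross edges are excluded because the new copy lies in
      -- sets already cleared of neighbours of the trees attached earlier.
      obtain ⟨χ, hχ⟩ : ∃ χ : U → V, χ = fun u => if u ∈ t.comp N then φ u else ψ u := ⟨_, rfl⟩
      have hχN : ∀ u ∈ t.comp N, χ u = φ u := fun u hu => by simp [hχ, hu]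
      have hχo : ∀ u ∈ t.att N, χ u = ψ u := fun u hu => by
        simp [hχ, hnotN u (Target.mem_att.1 hu)]
      have hpN : ∀ u ∈ t.comp N, Function.update (s.p k') (t.y N) (S.fin k'.1 l) u =
          Function.update t.pos (t.y N) (S.fin k'.1 l) u := by
        intro u hu
        by_cases hne : u = t.y N
        · rw [hne]; simp
        · rw [Function.update_of_ne hne, Function.update_of_ne hne]
          refine s.p_eq _ u fun i hi h => ?_
          exact hnotN u ⟨i, hi, h ▸ t.y_mem i (hi.trans hNm)⟩ hu
      have hpo : ∀ u ∈ t.att N, Function.update (s.p k') (t.y N) (S.fin k'.1 l) u = s.p k' u := by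
        intro u hu
        refine Function.update_of_ne (fun h => ?_) _ _
        obtain ⟨i, hi, hui⟩ := Target.mem_att.1 hu
        exact hynot i hi (h ▸ hui)
      rw [hattN]
      refine ⟨χ, ⟨?_, ?_, ?_⟩, ?_, ?_, ?_⟩
      · intro u hu hu1
        rcases mem_union.1 hu with hu | hu
        · rw [hχo u hu, hpo u hu]; exact hψ.mem₁ u hu hu1
        · rw [hχN u hu, hpN u hu]; exact hφ.mem₁ u hu hu1
      · intro u hu hu1
        rcases mem_union.1 hu with hu | hu
        · rw [hχo u hu, hpo u hu]; exact hψ.mem₂ u hu hu1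
        · rw [hχN u hu, hpN u hu]; exact hφ.mem₂ u hu hu1
      · intro u hu hu1 v hv hv2
        rcases mem_union.1 hu with hu | hu <;> rcases mem_union.1 hv with hv | hv
        · rw [hχo u hu, hχo v hv]; exact hψ.adj u hu hu1 v hv hv2
        · rw [hχo u hu, hχN v hv]
          obtain ⟨i, hi, hui⟩ := Target.mem_att.1 hu
          obtain ⟨h, h1, h2, h3⟩ := hFBm _ (hmB v hv hv2)
          exact iff_of_false (t.not_adj i (hi.trans hNm) N hNm hi.ne u hui v hv)
            (hψA u hu hu1 h h1 h2 _ h3)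
        · rw [hχN u hu, hχo v hv]
          obtain ⟨i, hi, hvi⟩ := Target.mem_att.1 hv
          obtain ⟨h, h1, h2, h3⟩ := hmCA u hu hu1
          exact iff_of_false (t.not_adj N hNm i (hi.trans hNm) hi.ne' u hu v hvi)
            fun hadj => hψB v hv hv2 h h1 h2 _ h3 hadj.symm
        · rw [hχN u hu, hχN v hv]; exact hφ.adj u hu hu1 v hv hv2
      · intro u hu hu1
        rcases mem_union.1 hu with hu | hu
        · rw [hχo u hu, hψw u hu hu1]
          constructor
          · rintro ⟨i, hi, rfl⟩; exact ⟨i, by omega, rfl⟩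
          · rintro ⟨i, hi, rfl⟩
            rcases Nat.lt_succ_iff_lt_or_eq.1 hi with hi | rfl
            · exact ⟨i, hi, rfl⟩
            · exact absurd hy (hnotN _ (Target.mem_att.1 hu))
        · rw [hχN u hu]
          by_cases hne : u = t.y N
          · subst hne
            exact iff_of_true hwr ⟨N, by omega, rfl⟩
          · refine iff_of_false (hwF _ (hmF u hu hu1 hne)) ?_
            rintro ⟨i, hi, rfl⟩
            rcases Nat.lt_succ_iff_lt_or_eq.1 hi with hi | rfl
            · exact hnotN _ ⟨i, hi, t.y_mem i (hi.trans hNm)⟩ hu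
            · exact hne rfl
      · intro u hu hu1 h h1 h2 v hv
        rw [mem_sdiff] at hv
        rcases mem_union.1 hu with hu | hu
        · rw [hχo u hu]; exact hψA u hu hu1 h h1 h2 v hv.1
        · rw [hχN u hu]
          exact fun hadj => hv.2 (mem_nbs.2 ⟨_, hmMA u hu hu1, hadj⟩)
      · intro u hu hu1 h h1 h2 v hv
        rw [mem_sdiff] at hv
        rcases mem_union.1 hu with hu | hu
        · rw [hχo u hu]; exact hψB u hu hu1 h (by omega) (by omega) v hv.1
        · rw [hχN u hu]
          exact fun hadj => hv.2 (mem_nbs.2 ⟨_, hmMB u hu hu1, hadj⟩)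

/-- One of the two targets is realized. -/
theorem exists_realized (tg : ∀ e, Target T S δ e)
    (hK : 8 * δ + 4 ≤ S.K) (hκ : S.κ ≤ 1 / 2 ^ (20 * δ + 14))
    (hlam : (4 * δ + 1) * S.lam ≤ 1 / 4) : ∃ e, Realized T S e (tg e).D ((tg e).y 0) := by
  by_contra! hcon
  have hn : ∀ l ≤ 4 * δ + 1, ∀ s : Attached tg l, ∀ k, s.n k < (tg k.1).m := fun l hl s k =>
    lt_of_le_of_ne (s.n_le k) fun h => hcon k.1 (s.realized (by omega) hl h)
  have key : ∀ l ≤ 4 * δ + 1, Nonempty (Attached tg l) := by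
    intro l
    induction l with
    | zero => exact fun _ => ⟨init tg⟩
    | succ l ih =>
      intro hl
      obtain ⟨s⟩ := ih (by omega)
      exact s.exists_next (by omega) (hn l (by omega) s) hK hκ hlam
  obtain ⟨s⟩ := key _ le_rfl
  -- No kind is finished, so each of the four counts is at most `m - 1 ≤ δ`, although they sum to `4
  -- * δ + 1`.
  have h1 : ∑ k, s.n k ≤ ∑ _k : Bool × Bool, δ :=
    sum_le_sum fun k _ => by
      have := hn _ le_rfl s k
      have := (tg k.1).m_le
      omega
  rw [s.n_sum] at h1
  simp at h1

end Attached

end Copies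

/-! ### Ranks in a finite set. -/

section Ranks

/-- The number of elements of `E` with smaller key. -/
noncomputable def rankIn {U α : Type*} [LinearOrder α] (E : Finset U) (key : U → α) (u : U) : ℕ :=
  #{v ∈ E | key v < key u}

theorem rankIn_lt_card {U α : Type*} [LinearOrder α] {E : Finset U} {key : U → α} {u : U}
    (hu : u ∈ E) : rankIn E key u < #E :=
  card_lt_card (filter_ssubset.2 ⟨u, hu, lt_irrefl _⟩)

theorem rankIn_lt_rankIn {U α : Type*} [LinearOrder α] {E : Finset U} {key : U → α} {u v : U}
    (hu : u ∈ E) (h : key u < key v) : rankIn E key u < rankIn E key v := by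
  refine card_lt_card ⟨fun w => ?_, fun hsub => ?_⟩
  · simp only [mem_filter]
    exact fun hw => ⟨hw.1, hw.2.trans h⟩
  · have : u ∈ {w ∈ E | key w < key u} := hsub (mem_filter.2 ⟨hu, h⟩)
    simp at this

theorem rankIn_inj {U α : Type*} [LinearOrder α] {E : Finset U} {key : U → α} {u v : U}
    (hu : u ∈ E) (hv : v ∈ E) (h : rankIn E key u = rankIn E key v) : key u = key v := by
  rcases lt_trichotomy (key u) (key v) with h1 | h1 | h1
  · have := rankIn_lt_rankIn hu h1; omega
  · exact h1
  · have := rankIn_lt_rankIn hv h1; omega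

end Ranks

/-! ### Branches of a forest at a vertex. -/

section Branches

variable {U : Type*} (Γ : SimpleGraph U)

/-- Adjacency inside `D`. -/
def AdjIn (D : Set U) (a b : U) : Prop := Γ.Adj a b ∧ a ∈ D ∧ b ∈ D

/-- `D` induces a connected (possibly empty) graph. -/
def ConnIn (D : Set U) : Prop := ∀ u ∈ D, ∀ v ∈ D, Relation.ReflTransGen (AdjIn Γ D) u v

variable {Γ}

theorem AdjIn.symm {D : Set U} {a b : U} (h : AdjIn Γ D a b) : AdjIn Γ D b a :=
  ⟨h.1.symm, h.2.2, h.2.1⟩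

theorem reflTransGen_adjIn_symm {D : Set U} {a b : U} (h : Relation.ReflTransGen (AdjIn Γ D) a b) :
    Relation.ReflTransGen (AdjIn Γ D) b a := by
  induction h with
  | refl => exact .refl
  | tail _ h ih => exact .head h.symm ih

theorem mem_of_reflTransGen_adjIn {D : Set U} {a b : U} (ha : a ∈ D)
    (h : Relation.ReflTransGen (AdjIn Γ D) a b) : b ∈ D := by
  cases h with
  | refl => exact ha
  | tail _ h => exact h.2.2

theorem ConnIn.induce_connected {D : Set U} (h : ConnIn Γ D) (hne : D.Nonempty) :
    (Γ.induce D).Connected := by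
  have key : ∀ u v (hu : u ∈ D), Relation.ReflTransGen (AdjIn Γ D) u v →
      ∃ hv : v ∈ D, (Γ.induce D).Reachable ⟨u, hu⟩ ⟨v, hv⟩ := by
    intro u v hu huv
    induction huv with
    | refl => exact ⟨hu, .refl _⟩
    | tail _ hbc ih =>
      obtain ⟨hb, hr⟩ := ih
      refine ⟨hbc.2.2, hr.trans (SimpleGraph.Adj.reachable ?_)⟩
      exact hbc.1
  have : Nonempty D := hne.to_subtype
  refine ⟨fun u v => ?_⟩
  obtain ⟨_, hr⟩ := key u v u.2 (h u u.2 v v.2)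
  exact hr

theorem connIn_univ (h : Γ.Connected) : ConnIn Γ Set.univ := by
  intro u _ v _
  obtain ⟨p⟩ := h.preconnected u v
  induction p with
  | nil => exact .refl
  | cons hadj _ ih => exact .head ⟨hadj, trivial, trivial⟩ (ih trivial trivial)

/-- In a forest, a vertex has at most one neighbour in each component of the rest. -/
theorem eq_of_reflTransGen_adjIn (hΓ : Γ.IsAcyclic) {D : Set U} {x y u : U}
    (hyu : Relation.ReflTransGen (AdjIn Γ (D \ {x})) y u) (hy : Γ.Adj x y) (hu : Γ.Adj x u) :
    y = u := by
  by_contra hne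
  have hb := SimpleGraph.isAcyclic_iff_forall_adj_isBridge.1 hΓ hy
  rw [SimpleGraph.isBridge_iff] at hb
  apply hb
  -- A path that avoids `x` avoids the edge from `x` to `y`; closing it up through `u` would show
  -- that this edge is not a bridge.
  have h1 : ∀ v, Relation.ReflTransGen (AdjIn Γ (D \ {x})) y v →
      (Γ.deleteEdges {s(x, y)}).Reachable y v := by
    intro v hv
    induction hv with
    | refl => exact .refl _
    | tail _ hbc ih =>
      refine ih.trans (SimpleGraph.Adj.reachable ?_)
      rw [SimpleGraph.deleteEdges_adj]
      refine ⟨hbc.1, fun h => ?_⟩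
      have h2 := hbc.2.1.2
      have h3 := hbc.2.2.2
      simp only [Set.mem_singleton_iff, Sym2.eq_iff] at h h2 h3
      tauto
  refine SimpleGraph.Reachable.trans (SimpleGraph.Adj.reachable ?_) (h1 u hyu).symm
  rw [SimpleGraph.deleteEdges_adj]
  refine ⟨hu, fun h => ?_⟩
  simp only [Set.mem_singleton_iff, Sym2.eq_iff] at h
  rcases h with ⟨-, h⟩ | ⟨h, -⟩
  · exact hne h.symm
  · exact hy.ne h

variable (Γ) in
open Classical in
/-- The component of `y` in `D` without `x`. -/
noncomputable def branch [Fintype U] (D : Finset U) (x y : U) : Finset U :=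
  univ.filter (Relation.ReflTransGen (AdjIn Γ ((D : Set U) \ {x})) y)

variable [Fintype U] {D : Finset U} {x y : U}

theorem mem_branch {u : U} :
    u ∈ branch Γ D x y ↔ Relation.ReflTransGen (AdjIn Γ ((D : Set U) \ {x})) y u := by
  simp [branch]

theorem self_mem_branch : y ∈ branch Γ D x y := mem_branch.2 .refl

theorem branch_subset (hy : y ∈ (D : Set U) \ {x}) {u : U} (hu : u ∈ branch Γ D x y) :
    u ∈ (D : Set U) \ {x} := mem_of_reflTransGen_adjIn hy (mem_branch.1 hu)

theorem connIn_branch : ConnIn Γ (branch Γ D x y : Set U) := by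
  have key : ∀ u, Relation.ReflTransGen (AdjIn Γ ((D : Set U) \ {x})) y u →
      Relation.ReflTransGen (AdjIn Γ (branch Γ D x y : Set U)) y u := by
    intro u hu
    induction hu with
    | refl => exact .refl
    | tail hyb hbc ih =>
      exact ih.tail ⟨hbc.1, mem_coe.2 (mem_branch.2 hyb), mem_coe.2 (mem_branch.2 (hyb.tail hbc))⟩
  intro u hu v hv
  exact (reflTransGen_adjIn_symm (key u (mem_branch.1 (mem_coe.1 hu)))).trans
    (key v (mem_branch.1 (mem_coe.1 hv)))

theorem exists_mem_branch (hD : ConnIn Γ (D : Set U)) (hx : x ∈ D) {u : U} (hu : u ∈ D)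
    (hux : u ≠ x) : ∃ z ∈ D, Γ.Adj x z ∧ u ∈ branch Γ D x z := by
  have key : ∀ v, Relation.ReflTransGen (AdjIn Γ (D : Set U)) x v → v = x ∨
      ∃ z ∈ D, Γ.Adj x z ∧ v ∈ branch Γ D x z := by
    intro v hv
    induction hv with
    | refl => exact Or.inl rfl
    | @tail b c _ hbc ih =>
      by_cases hc : c = x
      · exact Or.inl hc
      right
      by_cases hb : b = x
      · subst hb; exact ⟨c, hbc.2.2, hbc.1, self_mem_branch⟩
      · obtain ⟨z, hz, hxz, hzb⟩ := ih.resolve_left hb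
        exact ⟨z, hz, hxz, mem_branch.2 ((mem_branch.1 hzb).tail
          ⟨hbc.1, ⟨hbc.2.1, hb⟩, ⟨hbc.2.2, hc⟩⟩)⟩
  exact (key u (hD x hx u hu)).resolve_left hux

/-- The two alternatives in `huv` give, for different neighbours of `x`, that their branches are
disjoint and that no edge joins them. -/
theorem branch_eq_of_adj (hΓ : Γ.IsAcyclic) {y' u v : U} (hy : Γ.Adj x y) (hy' : Γ.Adj x y')
    (hu : u ∈ branch Γ D x y) (hv : v ∈ branch Γ D x y')
    (huv : u = v ∨ AdjIn Γ ((D : Set U) \ {x}) u v) : y = y' := by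
  rw [mem_branch] at hu hv
  refine eq_of_reflTransGen_adjIn hΓ (D := (D : Set U)) ?_ hy hy'
  rcases huv with rfl | huv
  · exact hu.trans (reflTransGen_adjIn_symm hv)
  · exact (hu.tail huv).trans (reflTransGen_adjIn_symm hv)

end Branches

/-- Index 0 is reserved for the mark, so that its branch is attached first and it ends up in the
outermost block. -/
theorem exists_enumeration {U : Type*} [DecidableEq U] {s : Finset U} {r : U} (hr : r ∈ s) :
    ∃ y : ℕ → U, y 0 = r ∧ (∀ i < #s, y i ∈ s) ∧ (∀ u ∈ s, ∃ i < #s, y i = u) ∧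
      ∀ i < #s, ∀ j < #s, y i = y j → i = j := by
  set L := r :: (s.erase r).toList with hL
  have hlen : L.length = #s := by
    simp [hL, card_erase_of_mem hr]
    have := card_pos.2 ⟨r, hr⟩
    omega
  have hnd : L.Nodup := by simp [hL, nodup_toList]
  have hmem : ∀ u, u ∈ L ↔ u ∈ s := by
    intro u
    simp only [hL, List.mem_cons, mem_toList, mem_erase]
    by_cases h : u = r
    · subst h; simp [hr]
    · simp [h]
  refine ⟨fun i => L.getD i r, by simp [hL], ?_, ?_, ?_⟩
  · intro i hi
    rw [← hlen] at hi
    simp only [List.getD_eq_getElem _ _ hi, ← hmem]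
    exact List.getElem_mem hi
  · intro u hu
    obtain ⟨i, hi, h⟩ := List.getElem_of_mem ((hmem u).2 hu)
    exact ⟨i, hlen ▸ hi, by simp only [List.getD_eq_getElem _ _ hi, h]⟩
  · intro i hi j hj h
    rw [← hlen] at hi hj
    simp only [List.getD_eq_getElem _ _ hi, List.getD_eq_getElem _ _ hj] at h
    exact (List.Nodup.getElem_inj_iff hnd).1 h

/-! ### The minimal counterexamples and the induction on subtrees. -/

section Trees

variable {U V : Type*} [Fintype U] [DecidableEq U] [Fintype V] [DecidableEq V]

/-- Copies of trees can be moved to any order-equivalent blocks, and into any not too small subsets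
of these. -/
def Transfers (T : Bigraph U) (S : Host V) : Prop :=
  ∀ D : Finset U, (T.graph.induce (D : Set U)).IsTree → #D ≤ S.τ →
    ∀ pos φ, IsPlacement T S.K D pos → IsCopy T S S.A S.B D pos φ →
    ∀ pos', IsPlacement T S.K D pos' →
    (∀ u ∈ D, u ∈ T.V₁ → ∀ v ∈ D, v ∈ T.V₁ → pos u < pos v → pos' u < pos' v) →
    (∀ u ∈ D, u ∈ T.V₂ → ∀ v ∈ D, v ∈ T.V₂ → pos u < pos v → pos' u < pos' v) →
    ∀ X Y : ℕ → Finset V, (∀ h < S.K, X h ⊆ S.A h ∧ S.κ * S.W ≤ #(X h)) →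
    (∀ h < S.K, Y h ⊆ S.B h ∧ S.κ * S.W ≤ #(Y h)) →
    ∃ φ', IsCopy T S X Y D pos' φ'

variable {T : Bigraph U} {S : Host V} {δ : ℕ}

/-- If all smaller trees are realized, then the branches at a neighbour of the root can be used
as a target. -/
theorem exists_target (hT : T.graph.IsAcyclic) (hS : Transfers T S) (hU : Fintype.card U ≤ S.τ)
    (hK : 8 * δ + S.τ + 4 ≤ S.K) (hdeg : ∀ u, T.degree u ≤ δ + 1) {e : Bool} {D : Finset U}
    {r x : U} (hD : ConnIn T.graph (D : Set U)) (hr : r ∈ D) (hr1 : r ∈ T.V₁) (hx : x ∈ D)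
    (hxr : T.graph.Adj x r)
    (hmin : ∀ D' : Finset U, #D' < #D → ConnIn T.graph (D' : Set U) → ∀ r' ∈ D', r' ∈ T.V₁ →
      Realized T S e D' r') :
    ∃ t : Target T S δ e, t.D = D ∧ t.y 0 = r := by
  classical
  have hx2 : x ∈ T.V₂ := by
    rcases T.bipartite _ _ hxr with h | h
    · exact absurd h.2 (T.disj _ hr1)
    · exact h.1
  have hadj1 : ∀ u, T.graph.Adj x u → u ∈ T.V₁ := by
    intro u hu
    rcases T.bipartite _ _ hu with h | h
    · exact absurd hx2 (T.disj _ h.1)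
    · exact h.2
  set N : Finset U := {u ∈ D | T.graph.Adj x u} with hN
  obtain ⟨y, hy0, hyN, hyS, hyI⟩ := exists_enumeration (s := N) (r := r) (by simp [hN, hr, hxr])
  set m := #N
  have hm0 : 0 < m := card_pos.2 ⟨r, by simp [hN, hr, hxr]⟩
  have hm : m ≤ δ + 1 := by
    refine le_trans ?_ (hdeg x)
    rw [Bigraph.degree, show m = (N : Set U).ncard from (Set.ncard_coe_finset N).symm]
    exact Set.ncard_le_ncard (fun u hu => by simpa [hN] using (mem_filter.1 (mem_coe.1 hu)).2)
      (Set.toFinite _)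
  have hyadj : ∀ i < m, T.graph.Adj x (y i) := fun i hi => (mem_filter.1 (hyN i hi)).2
  have hyD : ∀ i < m, y i ∈ (D : Set U) \ {x} := fun i hi =>
    ⟨(mem_filter.1 (hyN i hi)).1, (hyadj i hi).ne'⟩
  obtain ⟨comp, hcomp⟩ : ∃ comp : ℕ → Finset U, comp = fun i => branch T.graph D x (y i) :=
    ⟨_, rfl⟩
  have hsub : ∀ i < m, ∀ u ∈ comp i, u ∈ (D : Set U) \ {x} := by
    intro i hi u hu; subst hcomp; exact branch_subset (hyD i hi) hu
  have hconn : ∀ i, ConnIn T.graph (comp i : Set U) := by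
    intro i; subst hcomp; exact connIn_branch
  have hymem : ∀ i, y i ∈ comp i := by intro i; subst hcomp; exact self_mem_branch
  have huniq : ∀ i < m, ∀ j < m, ∀ u ∈ comp i, ∀ v ∈ comp j, u = v ∨ T.graph.Adj u v → i = j := by
    intro i hi j hj u hu v hv huv
    refine hyI i hi j hj ?_
    have h1 := hsub i hi u hu
    have h2 := hsub j hj v hv
    subst hcomp
    exact branch_eq_of_adj hT (hyadj i hi) (hyadj j hj) hu hv (huv.imp id fun h => ⟨h, h1, h2⟩)
  have hlt : ∀ i < m, #(comp i) < #D := by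
    intro i hi
    refine card_lt_card ⟨fun u hu => (hsub i hi u hu).1, fun h => ?_⟩
    exact (hsub i hi x (h hx)).2 rfl
  have hreal : ∀ i, ∃ pos φ, i < m → IsPlacement T S.K (comp i) pos ∧
      IsCopy T S S.A S.B (comp i) pos φ ∧
      ∀ u ∈ comp i, u ∈ T.V₁ → u ≠ y i → Outside e (pos (y i)) (pos u) := by
    intro i
    by_cases hi : i < m
    · obtain ⟨pos, φ, h⟩ := hmin (comp i) (hlt i hi) (hconn i) (y i) (hymem i)
        (hadj1 _ (hyadj i hi))
      exact ⟨pos, φ, fun _ => h⟩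
    · have : Nonempty V := by
        have h1 := S.card_A 0 (by have := S.one_lt_K; omega)
        have h2 : (0 : ℝ) < #(S.A 0) := h1 ▸ S.W_pos
        exact ⟨(card_pos.1 (by exact_mod_cast h2)).choose⟩
      exact ⟨fun _ => 0, fun _ => Classical.arbitrary V, fun h => absurd h hi⟩
  choose ppos φ hreal using hreal
  let E : Finset U := (range m).biUnion comp
  have hE : ∀ u, u ∈ E ↔ ∃ i < m, u ∈ comp i := by intro u; simp [E]
  have hind : ∃ ind : U → ℕ, ∀ i < m, ∀ u ∈ comp i, ind u = i := by
    refine ⟨fun u => if h : ∃ i < m, u ∈ comp i then h.choose else 0, fun i hi u hu => ?_⟩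
    have h : ∃ i < m, u ∈ comp i := ⟨i, hi, hu⟩
    simp only [dif_pos h]
    exact huniq _ h.choose_spec.1 i hi u h.choose_spec.2 u hu (Or.inl rfl)
  obtain ⟨ind, hind⟩ := hind
  -- The lexicographic key lists the branches one after another, each in the order of its own
  -- realization.
  obtain ⟨key, hkey⟩ : ∃ key : U → ℕ ×ₗ ℕ, key = fun u => toLex (ind u, ppos (ind u) u) :=
    ⟨_, rfl⟩
  have hkeylt : ∀ i < m, ∀ u ∈ comp i, ∀ v ∈ comp i, ppos i u < ppos i v → key u < key v := by
    intro i hi u hu v hv huv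
    simp only [hkey, hind i hi u hu, hind i hi v hv, Prod.Lex.toLex_lt_toLex]
    exact Or.inr ⟨trivial, huv⟩
  have hkeyeq : ∀ i < m, ∀ u ∈ comp i, ∀ j < m, ∀ v ∈ comp j, key u = key v →
      i = j ∧ ppos i u = ppos i v := by
    intro i hi u hu j hj v hv h
    simp only [hkey, hind i hi u hu, hind j hj v hv, EmbeddingLike.apply_eq_iff_eq,
      Prod.mk.injEq] at h
    obtain ⟨rfl, h⟩ := h
    exact ⟨rfl, h⟩
  -- The shifts, with the size of `K`, leave `4 * δ + 1` blocks of `A` free at each end for the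
  -- roots, and the first and last blocks of `B` for the centres.
  obtain ⟨pos, hpos⟩ : ∃ pos : U → ℕ, pos = fun u => if u ∈ T.V₁ then
      4 * δ + 1 + rankIn {v ∈ E | v ∈ T.V₁} key u else 1 + rankIn {v ∈ E | v ∈ T.V₂} key u :=
    ⟨_, rfl⟩
  have hpos1 : ∀ u ∈ T.V₁, pos u = 4 * δ + 1 + rankIn {v ∈ E | v ∈ T.V₁} key u := by
    intro u hu; simp [hpos, hu]
  have hpos2 : ∀ u ∈ T.V₂, pos u = 1 + rankIn {v ∈ E | v ∈ T.V₂} key u := by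
    intro u hu
    have : u ∉ T.V₁ := fun h => T.disj u h hu
    simp [hpos, this]
  have hE1 : ∀ i < m, ∀ u ∈ comp i, u ∈ T.V₁ → u ∈ ({v ∈ E | v ∈ T.V₁} : Finset U) :=
    fun i hi u hu hu1 => mem_filter.2 ⟨(hE u).2 ⟨i, hi, hu⟩, hu1⟩
  have hE2 : ∀ i < m, ∀ u ∈ comp i, u ∈ T.V₂ → u ∈ ({v ∈ E | v ∈ T.V₂} : Finset U) :=
    fun i hi u hu hu1 => mem_filter.2 ⟨(hE u).2 ⟨i, hi, hu⟩, hu1⟩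
  have hp1 : ∀ i < m, ∀ u ∈ comp i, u ∈ T.V₁ → 4 * δ < pos u ∧ pos u + 4 * δ < S.K - 1 := by
    intro i hi u hu hu1
    have h1 := rankIn_lt_card (key := key) (hE1 i hi u hu hu1)
    have h2 := (card_le_univ ({v ∈ E | v ∈ T.V₁} : Finset U)).trans hU
    rw [hpos1 u hu1]
    omega
  have hp2 : ∀ i < m, ∀ u ∈ comp i, u ∈ T.V₂ → 0 < pos u ∧ pos u < S.K - 1 := by
    intro i hi u hu hu1
    have h1 := rankIn_lt_card (key := key) (hE2 i hi u hu hu1)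
    have h2 := (card_le_univ ({v ∈ E | v ∈ T.V₂} : Finset U)).trans hU
    rw [hpos2 u hu1]
    omega
  have hi1 : ∀ i < m, ∀ u ∈ comp i, u ∈ T.V₁ → ∀ j < m, ∀ v ∈ comp j, v ∈ T.V₁ →
      pos u = pos v → u = v := by
    intro i hi u hu hu1 j hj v hv hv1 h
    rw [hpos1 u hu1, hpos1 v hv1] at h
    obtain ⟨rfl, h⟩ := hkeyeq i hi u hu j hj v hv
      (rankIn_inj (hE1 i hi u hu hu1) (hE1 j hj v hv hv1) (by omega))
    exact (hreal i hi).1.inj₁ u hu hu1 v hv hv1 h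
  have hi2 : ∀ i < m, ∀ u ∈ comp i, u ∈ T.V₂ → ∀ j < m, ∀ v ∈ comp j, v ∈ T.V₂ →
      pos u = pos v → u = v := by
    intro i hi u hu hu1 j hj v hv hv1 h
    rw [hpos2 u hu1, hpos2 v hv1] at h
    obtain ⟨rfl, h⟩ := hkeyeq i hi u hu j hj v hv
      (rankIn_inj (hE2 i hi u hu hu1) (hE2 j hj v hv hv1) (by omega))
    exact (hreal i hi).1.inj₂ u hu hu1 v hv hv1 h
  refine ⟨{
    x := x
    m := m
    comp := comp
    y := y
    pos := pos
    m_pos := hm0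
    m_le := hm
    x_mem := hx2
    y_mem := fun i _ => hymem i
    y_mem₁ := fun i hi => hadj1 _ (hyadj i hi)
    x_notMem := fun i hi h => (hsub i hi x h).2 rfl
    disjoint := fun i hi j hj hij => disjoint_left.2 fun u hu hu' =>
      hij (huniq i hi j hj u hu u hu' (Or.inl rfl))
    not_adj := fun i hi j hj hij u hu v hv h => hij (huniq i hi j hj u hu v hv (Or.inr h))
    adj_x := ?_
    card_le := fun i _ => (card_le_univ _).trans hU
    pos₁ := hp1
    pos₂ := hp2
    inj₁ := hi1
    inj₂ := hi2
    copies := ?_ }, ?_, hy0⟩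
  · intro i hi u hu
    refine ⟨fun h => ?_, fun h => h ▸ hyadj i hi⟩
    have hu' := hu
    rw [hcomp, mem_branch] at hu
    exact (eq_of_reflTransGen_adjIn hT hu (hyadj i hi) h).symm
  · intro i hi l hl X Y hX hY
    obtain ⟨hplace, hcopy, hroot⟩ := hreal i hi
    have htree : (T.graph.induce (comp i : Set U)).IsTree :=
      ⟨(hconn i).induce_connected ⟨y i, hymem i⟩, hT.induce _⟩
    -- Moving the root to an outer block preserves the order, as it is already extreme at end `e` by
    -- `hroot`. All other vertices keep their relative order through ranks, so `Transfers` applies.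
    have hfin : S.fin e l ≤ 4 * δ ∧ e = true ∨
        S.K - 1 ≤ S.fin e l + 4 * δ ∧ S.fin e l < S.K ∧ e = false := by
      unfold Host.fin
      cases e <;> simp <;> omega
    have hne2 : ∀ u ∈ T.V₂, u ≠ y i := fun u hu h =>
      T.disj _ (hadj1 _ (hyadj i hi)) (h ▸ hu)
    refine hS (comp i) htree ((card_le_univ _).trans hU) (ppos i) (φ i) hplace hcopy _ ⟨?_, ?_, ?_⟩
      ?_ ?_ X Y hX hY
    · intro u hu
      by_cases h : u = y i
      · subst h; rw [Function.update_self]; omega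
      · rw [Function.update_of_ne h]
        rcases T.cover u with h1 | h2
        · have := hp1 i hi u hu h1; omega
        · have := hp2 i hi u hu h2; omega
    · intro u hu hu1 v hv hv1 huv
      have h1 := hp1 i hi u hu hu1
      have h2 := hp1 i hi v hv hv1
      by_cases hu' : u = y i <;> by_cases hv' : v = y i
      · rw [hu', hv']
      · subst hu'
        rw [Function.update_self, Function.update_of_ne hv'] at huv
        omega
      · subst hv'
        rw [Function.update_self, Function.update_of_ne hu'] at huv
        omega
      · rw [Function.update_of_ne hu', Function.update_of_ne hv'] at huv
        exact hi1 i hi u hu hu1 i hi v hv hv1 huv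
    · intro u hu hu2 v hv hv2 huv
      rw [Function.update_of_ne (hne2 u hu2), Function.update_of_ne (hne2 v hv2)] at huv
      exact hi2 i hi u hu hu2 i hi v hv hv2 huv
    · intro u hu hu1 v hv hv1 huv
      have h1 := hp1 i hi u hu hu1
      have h2 := hp1 i hi v hv hv1
      have h3 := hroot u hu hu1
      have h4 := hroot v hv hv1
      unfold Outside at h3 h4
      by_cases hu' : u = y i <;> by_cases hv' : v = y i
      · rw [hu', hv'] at huv; omega
      · subst hu'
        rw [Function.update_self, Function.update_of_ne hv']
        have h4 := h4 hv'
        rcases hfin with ⟨h5, rfl⟩ | ⟨h5, h6, rfl⟩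
        · omega
        · simp at h4; omega
      · subst hv'
        rw [Function.update_self, Function.update_of_ne hu']
        have h3 := h3 hu'
        rcases hfin with ⟨h5, rfl⟩ | ⟨h5, h6, rfl⟩
        · simp at h3; omega
        · omega
      · rw [Function.update_of_ne hu', Function.update_of_ne hv', hpos1 u hu1, hpos1 v hv1]
        have := rankIn_lt_rankIn (hE1 i hi u hu hu1) (hkeylt i hi u hu v hv huv)
        omega
    · intro u hu hu2 v hv hv2 huv
      rw [Function.update_of_ne (hne2 u hu2), Function.update_of_ne (hne2 v hv2), hpos2 u hu2,
        hpos2 v hv2]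
      have := rankIn_lt_rankIn (hE2 i hi u hu hu2) (hkeylt i hi u hu v hv huv)
      omega
  · ext u
    simp only [Target.D, mem_insert, Target.mem_att]
    constructor
    · rintro (rfl | ⟨i, hi, hu⟩)
      exacts [hx, (hsub i hi u hu).1]
    · intro hu
      by_cases hux : u = x
      · exact Or.inl hux
      · obtain ⟨z, hz, hxz, hzu⟩ := exists_mem_branch hD hx hu hux
        obtain ⟨i, hi, rfl⟩ := hyS z (by simp [hN, hz, hxz])
        exact Or.inr ⟨i, hi, by rw [hcomp]; exact hzu⟩

omit [Fintype U] [DecidableEq U] in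
theorem realized_singleton (S : Host V) (T : Bigraph U) (e : Bool) {r : U} (hr1 : r ∈ T.V₁) :
    Realized T S e {r} r := by
  have h0 : 0 < S.K := by have := S.one_lt_K; omega
  have h1 := S.card_A 0 h0
  have h2 : (0 : ℝ) < #(S.A 0) := h1 ▸ S.W_pos
  obtain ⟨v, hv⟩ := card_pos.1 (by exact_mod_cast h2 : 0 < #(S.A 0))
  have hr2 : r ∉ T.V₂ := T.disj r hr1
  refine ⟨fun _ => 0, fun _ => v, ⟨?_, ?_, ?_⟩, ⟨?_, ?_, ?_⟩, ?_⟩ <;> simp [h0, hv, hr1, hr2]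

/-- The whole tree is realized, with a prescribed root in first or in last position. -/
theorem exists_realized_univ (hT : T.graph.IsTree) (hS : Transfers T S)
    (hU : Fintype.card U ≤ S.τ) (hK : 8 * δ + S.τ + 4 ≤ S.K) (hdeg : ∀ u, T.degree u ≤ δ + 1)
    (hκ : S.κ ≤ 1 / 2 ^ (20 * δ + 14)) (hlam : (4 * δ + 1) * S.lam ≤ 1 / 4)
    {r : U} (hr : r ∈ T.V₁) : ∃ e, Realized T S e univ r := by
  classical
  by_contra! hcon
  -- The two ends have independent smallest counterexamples, with possibly different parts and
  -- marks; both are attacked at once, since a round cannot choose its end.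
  have key : ∀ e, ∃ (t : Target T S δ e), ¬ Realized T S e t.D (t.y 0) := by
    intro e
    have hex : ∃ n, ∃ D : Finset U, #D = n ∧ ConnIn T.graph (D : Set U) ∧ ∃ r ∈ D, r ∈ T.V₁ ∧
        ¬ Realized T S e D r :=
      ⟨_, univ, rfl, by rw [coe_univ]; exact connIn_univ hT.connected, r, mem_univ _, hr, hcon e⟩
    obtain ⟨D, hDn, hD, r', hr', hr1', hnot⟩ := Nat.find_spec hex
    have hmin : ∀ D' : Finset U, #D' < #D → ConnIn T.graph (D' : Set U) → ∀ r' ∈ D', r' ∈ T.V₁ →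
        Realized T S e D' r' := by
      intro D' hlt hD' s hs hs1
      by_contra h
      exact Nat.find_min hex (hDn ▸ hlt) ⟨D', rfl, hD', s, hs, hs1, h⟩
    obtain ⟨u, hu, hur⟩ : ∃ u ∈ D, u ≠ r' := by
      by_contra! h
      apply hnot
      have : D = {r'} := eq_singleton_iff_unique_mem.2 ⟨hr', h⟩
      rw [this]
      exact realized_singleton S T e hr1'
    obtain ⟨x, hx, -⟩ := ((hD r' hr' u hu).cases_head).resolve_left hur.symm
    obtain ⟨t, rfl, rfl⟩ := exists_target hT.isAcyclic hS hU hK hdeg hD hr' hr1' hx.2.2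
      hx.1.symm hmin
    exact ⟨t, hnot⟩
  choose tg htg using key
  obtain ⟨e, he⟩ := Attached.exists_realized tg (by omega) hκ hlam
  exact htg e he

end Trees

/-! ### The number of vertices of a rooted tree of bounded degree and depth. -/

section TreeSize

open SimpleGraph

variable {U : Type*} {Γ : SimpleGraph U}

theorem exists_adj_dist_lt (hΓ : Γ.Connected) {r u : U} (h : u ≠ r) :
    ∃ w, Γ.Adj u w ∧ Γ.dist r w < Γ.dist r u := by
  obtain ⟨p, hp⟩ := hΓ.exists_walk_length_eq_dist u r
  cases p with
  | nil => exact absurd rfl h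
  | cons hadj q =>
    refine ⟨_, hadj, ?_⟩
    have := dist_le q
    rw [dist_comm, dist_comm (u := r), ← hp, Walk.length_cons]
    omega

/-- In a rooted tree, the neighbours of a vertex which are closer to the root coincide. -/
theorem eq_of_adj_of_dist_lt (hΓ : Γ.IsTree) {r u v w : U} (hv : Γ.Adj u v) (hw : Γ.Adj u w)
    (hv' : Γ.dist r v < Γ.dist r u) (hw' : Γ.dist r w < Γ.dist r u) : v = w := by
  classical
  obtain ⟨q, hq, hq'⟩ := hΓ.connected.exists_path_of_dist r u
  have key : ∀ v, Γ.Adj u v → Γ.dist r v < Γ.dist r u → v = q.penultimate := by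
    intro v hv hv'
    obtain ⟨p, hp, hp'⟩ := hΓ.connected.exists_path_of_dist r v
    have hu : u ∉ p.support := by
      intro h
      have h1 := dist_le (p.takeUntil u h)
      have h2 := p.length_takeUntil_le_length h
      omega
    have hvq : v ∈ q.support := hΓ.isAcyclic.mem_support_of_ne_mem_support_of_adj_of_isPath hq hp hv hu
    rw [hΓ.isAcyclic.path_concat hp hq hv.symm hvq, Walk.penultimate_concat]
  rw [key v hv hv', key w hw hw']

theorem card_le_of_degree [Fintype U] {T : Bigraph U} (hT : T.IsTree) {δ η : ℕ} (hδ : 2 ≤ δ)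
    {root : U} (hdeg : ∀ u, T.degree u ≤ δ + 1) (hroot : T.degree root ≤ δ)
    (hpath : ∀ u, T.IsLeaf u → ∀ p : T.graph.Walk root u, p.IsPath → p.length < η) :
    Fintype.card U ≤ δ ^ (η + 1) := by
  classical
  -- A vertex farthest from the root, if not the root itself, has only its parent as neighbour, so
  -- it is a leaf and `hpath` bounds its distance.
  have hdist : ∀ u, T.graph.dist root u ≤ η := by
    obtain ⟨u, -, hu⟩ := (univ : Finset U).exists_max_image (T.graph.dist root) ⟨root, mem_univ _⟩
    intro v
    refine (hu v (mem_univ v)).trans ?_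
    by_cases hur : u = root
    · rw [hur]; simp
    obtain ⟨p, hp, hp'⟩ := hT.connected.exists_path_of_dist root u
    rw [← hp']
    refine (hpath u ?_ p hp).le
    obtain ⟨w, hw, hw'⟩ := exists_adj_dist_lt hT.connected hur
    have : T.graph.neighborSet u = {w} := by
      ext x
      simp only [SimpleGraph.mem_neighborSet, Set.mem_singleton_iff]
      refine ⟨fun hx => ?_, fun hx => hx ▸ hw⟩
      refine eq_of_adj_of_dist_lt hT hx hw ?_ hw'
      exact lt_of_le_of_ne (hu x (mem_univ x)) (hT.dist_ne_of_adj root hx).symm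
    rw [Bigraph.IsLeaf, Bigraph.degree, this, Set.ncard_singleton]
  let L : ℕ → Finset U := fun k => {u | T.graph.dist root u = k}
  -- A vertex other than the root spends one of its `δ + 1` edges on its parent.
  have hnext : ∀ v, #(nb T.graph v ∩ L (T.graph.dist root v + 1)) ≤ δ := by
    intro v
    have hd : #(nb T.graph v) = T.degree v := by
      rw [Bigraph.degree, ← Set.ncard_coe_finset]
      congr 1; ext x; simp
    by_cases hv : v = root
    · subst hv
      exact (card_le_card inter_subset_left).trans (hd ▸ hroot)
    · obtain ⟨w, hw, hw'⟩ := exists_adj_dist_lt hT.connected hv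
      have h1 : nb T.graph v ∩ L (T.graph.dist root v + 1) ⊆ (nb T.graph v).erase w := by
        intro x hx
        simp only [mem_inter, L, mem_filter, mem_univ, true_and] at hx
        refine mem_erase.2 ⟨fun h => ?_, hx.1⟩
        subst h; omega
      have h2 := card_le_card h1
      rw [card_erase_of_mem (mem_nb.2 hw), hd] at h2
      have := hdeg v
      omega
  have hL : ∀ k, #(L k) ≤ δ ^ k := by
    intro k
    induction k with
    | zero =>
      have : L 0 ⊆ {root} := by
        intro x hx
        simp only [L, mem_filter, mem_univ, true_and] at hx
        rw [mem_singleton]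
        exact ((hT.connected.dist_eq_zero_iff).1 hx).symm
      simpa using card_le_card this
    | succ k ih =>
      have : L (k + 1) ⊆ (L k).biUnion fun v => nb T.graph v ∩ L (T.graph.dist root v + 1) := by
        intro x hx
        have hx' : T.graph.dist root x = k + 1 := by simpa [L] using hx
        have hxr : x ≠ root := by rintro rfl; simp at hx'
        obtain ⟨w, hw, hw'⟩ := exists_adj_dist_lt hT.connected hxr
        have hwk : T.graph.dist root w = k := by
          rcases hT.dist_eq_dist_add_one_of_adj root hw with h | h <;> omega
        rw [mem_biUnion]
        refine ⟨w, by simp [L, hwk], ?_⟩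
        rw [mem_inter, mem_nb, hwk]
        exact ⟨hw.symm, hx⟩
      calc #(L (k + 1)) ≤ #(L k) * δ := (card_le_card this).trans
            (card_biUnion_le_card_mul _ _ _ fun v _ => hnext v)
        _ ≤ δ ^ k * δ := by gcongr
        _ = δ ^ (k + 1) := by rw [pow_succ]
  have huniv : (univ : Finset U) ⊆ (range (η + 1)).biUnion L := by
    intro x _
    rw [mem_biUnion]
    exact ⟨T.graph.dist root x, mem_range.2 (Nat.lt_succ_of_le (hdist x)), by simp [L]⟩
  calc Fintype.card U ≤ ∑ k ∈ range (η + 1), #(L k) := (card_le_card huniv).trans card_biUnion_le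
    _ ≤ ∑ k ∈ range (η + 1), δ ^ k := sum_le_sum fun k _ => hL k
    _ ≤ δ ^ (η + 1) := (Nat.geomSum_lt hδ fun k hk => mem_range.1 hk).le

end TreeSize

/-! ### From parades to hosts and back. -/

section Parades

theorem Bigraph.not_adj₁ {V : Type*} (G : Bigraph V) {u v : V} (hu : u ∈ G.V₁) (hv : v ∈ G.V₁) :
    ¬ G.graph.Adj u v := by
  intro h
  rcases G.bipartite _ _ h with h | h
  exacts [G.disj _ hv h.2, G.disj _ hu h.1]

theorem Bigraph.not_adj₂ {V : Type*} (G : Bigraph V) {u v : V} (hu : u ∈ G.V₂) (hv : v ∈ G.V₂) :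
    ¬ G.graph.Adj u v := by
  intro h
  rcases G.bipartite _ _ h with h | h
  exacts [G.disj _ h.1 hu, G.disj _ h.2 hv]

namespace Parade

variable {V : Type*} {G : Bigraph V} {K : ℕ}

/-- Disjointness of blocks makes `φ` injective, and bipartiteness settles all pairs on the same
side, so only adjacency across the sides has to be assumed. -/
theorem exists_embedding (P : Parade G K K) {I : Type*} (T : Bigraph I) (φ : I → V) (q : I → Fin K)
    (h₁ : ∀ u ∈ T.V₁, φ u ∈ P.A (q u)) (h₂ : ∀ u ∈ T.V₂, φ u ∈ P.B (q u))
    (inj₁ : ∀ u ∈ T.V₁, ∀ v ∈ T.V₁, q u = q v → u = v)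
    (inj₂ : ∀ u ∈ T.V₂, ∀ v ∈ T.V₂, q u = q v → u = v)
    (adj : ∀ u ∈ T.V₁, ∀ v ∈ T.V₂, T.graph.Adj u v ↔ G.graph.Adj (φ u) (φ v)) :
    ∃ F : T.Embedding G, (∀ u, F.toFun u = φ u) ∧ P.IsRainbow (Set.range F.toFun) := by
  have hA : ∀ u v i j, φ u ∈ P.A i → φ v ∈ P.A j → φ u = φ v → i = j := by
    intro u v i j hu hv h
    by_contra hij
    exact disjoint_left.1 (P.A_disjoint i j hij) hu (h ▸ hv)
  have hB : ∀ u v i j, φ u ∈ P.B i → φ v ∈ P.B j → φ u = φ v → i = j := by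
    intro u v i j hu hv h
    by_contra hij
    exact disjoint_left.1 (P.B_disjoint i j hij) hu (h ▸ hv)
  have m₁ : ∀ u ∈ T.V₁, φ u ∈ G.V₁ := fun u hu => P.A_subset _ (h₁ u hu)
  have m₂ : ∀ u ∈ T.V₂, φ u ∈ G.V₂ := fun u hu => P.B_subset _ (h₂ u hu)
  have hinj : Function.Injective φ := by
    intro u v h
    rcases T.cover u with hu | hu <;> rcases T.cover v with hv | hv
    · exact inj₁ u hu v hv (hA u v _ _ (h₁ u hu) (h₁ v hv) h)
    · exact absurd (m₂ v hv) (G.disj _ (h ▸ m₁ u hu))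
    · exact absurd (m₂ u hu) (G.disj _ (h ▸ m₁ v hv))
    · exact inj₂ u hu v hv (hB u v _ _ (h₂ u hu) (h₂ v hv) h)
  have hadj : ∀ u v, G.graph.Adj (φ u) (φ v) ↔ T.graph.Adj u v := by
    intro u v
    rcases T.cover u with hu | hu <;> rcases T.cover v with hv | hv
    · exact iff_of_false (G.not_adj₁ (m₁ u hu) (m₁ v hv)) (T.not_adj₁ hu hv)
    · exact (adj u hu v hv).symm
    · rw [G.graph.adj_comm, T.graph.adj_comm]; exact (adj v hv u hu).symm
    · exact iff_of_false (G.not_adj₂ (m₂ u hu) (m₂ v hv)) (T.not_adj₂ hu hv)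
  refine ⟨⟨⟨⟨φ, hinj⟩, fun {u v} => hadj u v⟩, m₁, m₂⟩, fun u => rfl, ?_⟩
  have hmA : ∀ u i, φ u ∈ P.A i → u ∈ T.V₁ := fun u i h => (T.cover u).resolve_right fun hu =>
    G.disj _ (P.A_subset _ h) (m₂ u hu)
  have hmB : ∀ u i, φ u ∈ P.B i → u ∈ T.V₂ := fun u i h => (T.cover u).resolve_left fun hu =>
    G.disj _ (m₁ u hu) (P.B_subset _ h)
  refine ⟨?_, ?_, ?_⟩
  · rintro _ ⟨u, rfl⟩
    rcases T.cover u with hu | hu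
    exacts [Or.inl ⟨_, h₁ u hu⟩, Or.inr ⟨_, h₂ u hu⟩]
  · rintro _ ⟨u, rfl⟩ _ ⟨v, rfl⟩ i (hu : φ u ∈ P.A i) (hv : φ v ∈ P.A i)
    have hu1 := hmA u i hu
    have hv1 := hmA v i hv
    have : u = v := inj₁ u hu1 v hv1 ((hA u u _ _ (h₁ u hu1) hu rfl).trans
      (hA v v _ _ (h₁ v hv1) hv rfl).symm)
    rw [this]
  · rintro _ ⟨u, rfl⟩ _ ⟨v, rfl⟩ i (hu : φ u ∈ P.B i) (hv : φ v ∈ P.B i)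
    have hu1 := hmB u i hu
    have hv1 := hmB v i hv
    have : u = v := inj₂ u hu1 v hv1 ((hB u u _ _ (h₂ u hu1) hu rfl).trans
      (hB v v _ _ (h₂ v hv1) hv rfl).symm)
    rw [this]

/-- The blocks, indexed by natural numbers. -/
def blocks {V : Type*} {K : ℕ} (A : Fin K → Finset V) (i : ℕ) : Finset V :=
  if h : i < K then A ⟨i, h⟩ else ∅

theorem blocks_of_lt {V : Type*} {K : ℕ} (A : Fin K → Finset V) {i : ℕ} (h : i < K) :
    blocks A i = A ⟨i, h⟩ := by simp [blocks, h]

/-- Blocks of a parade must have equal sizes, so every given set is trimmed to `⌈κ * W⌉₊` vertices.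
-/
theorem exists_subparade (P : Parade G K K) {κ W : ℝ} (hκ : 0 < κ * W)
    (hA : ∀ i, (#(P.A i) : ℝ) = W) (hB : ∀ i, (#(P.B i) : ℝ) = W) {X Y : ℕ → Finset V}
    (hX : ∀ h < K, X h ⊆ blocks P.A h ∧ κ * W ≤ #(X h))
    (hY : ∀ h < K, Y h ⊆ blocks P.B h ∧ κ * W ≤ #(Y h)) :
    ∃ P' : Parade G K K, P'.IsContraction P ∧ (∀ i, κ * #(P.A i) ≤ #(P'.A i)) ∧
      (∀ i, κ * #(P.B i) ≤ #(P'.B i)) ∧ (∀ i, P'.A i ⊆ X i) ∧ ∀ i, P'.B i ⊆ Y i := by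
  have key : ∀ (A : Fin K → Finset V) (X : ℕ → Finset V),
      (∀ h < K, X h ⊆ blocks A h ∧ κ * W ≤ #(X h)) →
      ∀ i : Fin K, ∃ Z ⊆ X i, Z ⊆ A i ∧ #Z = ⌈κ * W⌉₊ := by
    intro A X h i
    obtain ⟨h1, h2⟩ := h i i.2
    obtain ⟨Z, hZ, hZc⟩ := exists_subset_card_eq (Nat.ceil_le.2 h2)
    rw [blocks_of_lt A i.2] at h1
    exact ⟨Z, hZ, hZ.trans h1, hZc⟩
  choose A' hA'X hA'A hA'c using key P.A X hX
  choose B' hB'X hB'B hB'c using key P.B Y hY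
  have hpos : 0 < ⌈κ * W⌉₊ := Nat.ceil_pos.2 hκ
  refine ⟨⟨A', B', fun i => card_pos.1 (by rw [hA'c]; exact hpos),
    fun i => card_pos.1 (by rw [hB'c]; exact hpos), fun i => (hA'A i).trans (P.A_subset i),
    fun i => (hB'B i).trans (P.B_subset i),
    fun i j h => disjoint_of_subset_left (hA'A i) (disjoint_of_subset_right (hA'A j)
      (P.A_disjoint i j h)),
    fun i j h => disjoint_of_subset_left (hB'B i) (disjoint_of_subset_right (hB'B j)
      (P.B_disjoint i j h)),
    fun i j => by rw [hA'c, hA'c], fun i j => by rw [hB'c, hB'c]⟩, ⟨hA'A, hB'B⟩, ?_, ?_, hA'X, hB'X⟩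
  · intro i
    simp only [hA'c, hA]
    exact Nat.le_ceil _
  · intro i
    simp only [hB'c, hB]
    exact Nat.le_ceil _

end Parade

/-- Strictly monotone maps from a finite linear order with the same range agree. -/
theorem eq_of_strictMono_of_range_eq {α β : Type*} [Finite α] (o : LinearOrder α) [LinearOrder β]
    {f g : α → β} (hf : ∀ a b, o.lt a b → f a < f b) (hg : ∀ a b, o.lt a b → g a < g b)
    (h : Set.range f = Set.range g) : f = g := by
  let := o
  have : WellFoundedLT α := Finite.to_wellFoundedLT
  exact (StrictMono.range_inj (fun a b hab => hf a b hab) (fun a b hab => hg a b hab)).1 h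

end Parades

section Parades

variable {V : Type*} [Fintype V] [DecidableEq V] {G : Bigraph V} {K : ℕ}

omit [DecidableEq V] in
theorem Bigraph.card_nb (G : Bigraph V) (v : V) : #(nb G.graph v) = G.degree v := by
  rw [Bigraph.degree, ← Set.ncard_coe_finset]
  congr 1; ext x; simp

namespace Parade

theorem ncard_cover (X Y : Finset V) :
    ({y | y ∈ Y ∧ ∃ x ∈ X, G.graph.Adj x y} : Set V).ncard = #(nbs G.graph X ∩ Y) := by
  rw [← Set.ncard_coe_finset]
  congr 1; ext y; simp [mem_nbs, and_comm]

theorem ncard_miss (X Y : Finset V) :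
    ({y | y ∈ Y ∧ ¬ ∃ x ∈ X, G.graph.Adj x y} : Set V).ncard = #(Y \ nbs G.graph X) := by
  rw [← Set.ncard_coe_finset]
  congr 1; ext y; simp [mem_nbs]

/-- The host given by a parade. -/
noncomputable def toHost (P : Parade G K K) (hG : G.IsBalanced) {τ : ℕ} {W κ lam ε : ℝ}
    (hK : 1 < K) (hW : 0 < W) (hlam : 0 < lam) (hlamκ : lam ≤ κ) (hτ : τ * lam ≤ κ)
    (hκ : κ ≤ 1 / 2 ^ 14) (hA : ∀ i, (#(P.A i) : ℝ) = W) (hB : ∀ i, (#(P.B i) : ℝ) = W)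
    (hε : G.IsCoherent ε) (hεW : ε * #G.V₁ ≤ κ * W) (hconc : P.IsConcave lam) : Host V where
  H := G.graph
  A := blocks P.A
  B := blocks P.B
  K := K
  τ := τ
  W := W
  κ := κ
  lam := lam
  one_lt_K := hK
  W_pos := hW
  lam_pos := hlam
  lam_le := hlamκ
  tau_lam := hτ
  kappa_le := hκ
  card_A := fun i hi => by rw [blocks_of_lt _ hi, hA]
  card_B := fun i hi => by rw [blocks_of_lt _ hi, hB]
  deg_A := fun i hi v hv => by
    rw [blocks_of_lt _ hi] at hv
    rw [G.card_nb]
    have := hε.2.1 v (P.A_subset _ hv)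
    rw [← hG] at this
    linarith
  deg_B := fun i hi v hv => by
    rw [blocks_of_lt _ hi] at hv
    rw [G.card_nb]
    have := hε.2.2.1 v (P.B_subset _ hv)
    linarith
  edge := fun i hi j hj X hX Y hY hXc hYc => by
    rw [blocks_of_lt _ hi] at hX
    rw [blocks_of_lt _ hj] at hY
    by_contra! hcon
    refine hε.2.2.2 ⟨X, Y, hX.trans (P.A_subset _), hY.trans (P.B_subset _), hεW.trans hXc, ?_,
      fun x hx y hy => hcon x hx y hy⟩
    rw [← hG]; exact hεW.trans hYc
  conc_A := fun Y hY h₁ h₂ h₃ h12 h23 h3 hm₁ hm₃ => by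
    by_contra! hcon
    refine hconc.1 Y (fun y hy => ?_) ⟨⟨h₁, by omega⟩, ⟨h₂, by omega⟩, ⟨h₃, h3⟩, h12, h23, ?_⟩
    · obtain ⟨j, hj, hyj⟩ := hY y hy
      exact ⟨⟨j, hj⟩, by rwa [blocks_of_lt _ hj] at hyj⟩
    · rw [blocks_of_lt _ (by omega)] at hm₁ hm₃ hcon
      unfold Bigraph.Covers Bigraph.Misses
      rw [ncard_cover, ncard_miss, ncard_miss, hA, hA, hA]
      exact ⟨hcon, hm₁, hm₃⟩
  conc_B := fun Y hY h₁ h₂ h₃ h12 h23 h3 hm₁ hm₃ => by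
    by_contra! hcon
    refine hconc.2 Y (fun y hy => ?_) ⟨⟨h₁, by omega⟩, ⟨h₂, by omega⟩, ⟨h₃, h3⟩, h12, h23, ?_⟩
    · obtain ⟨j, hj, hyj⟩ := hY y hy
      exact ⟨⟨j, hj⟩, by rwa [blocks_of_lt _ hj] at hyj⟩
    · rw [blocks_of_lt _ (by omega)] at hm₁ hm₃ hcon
      unfold Bigraph.Covers Bigraph.Misses
      rw [ncard_cover, ncard_miss, ncard_miss, hB, hB, hB]
      exact ⟨hcon, hm₁, hm₃⟩

end Parade

/-- The part of `T` on the range of `f`, ordered by `pos`. -/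
noncomputable def orderedPart {U I : Type*} [Fintype I] [DecidableEq U] (T : Bigraph U) (f : I → U)
    (pos : I → ℕ)
    (h₁ : ∀ a b, f a ∈ T.V₁ → f b ∈ T.V₁ → pos a = pos b → a = b)
    (h₂ : ∀ a b, f a ∈ T.V₂ → f b ∈ T.V₂ → pos a = pos b → a = b) : OrderedBigraph I where
  graph := T.graph.comap f
  V₁ := univ.filter fun a => f a ∈ T.V₁
  V₂ := univ.filter fun a => f a ∈ T.V₂
  cover := fun a => by simpa using T.cover (f a)
  disj := fun a => by simpa using T.disj (f a)
  bipartite := fun a b h => by simpa using T.bipartite (f a) (f b) h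
  ord₁ := LinearOrder.lift' (fun a => pos a.1) fun a b h =>
    Subtype.ext (h₁ a.1 b.1 (mem_filter.1 a.2).2 (mem_filter.1 b.2).2 h)
  ord₂ := LinearOrder.lift' (fun a => pos a.1) fun a b h =>
    Subtype.ext (h₂ a.1 b.1 (mem_filter.1 a.2).2 (mem_filter.1 b.2).2 h)

namespace Parade

omit [Fintype V] [DecidableEq V] in
/-- In a copy of an ordered bigraph, the block of a vertex is determined by the support. -/
theorem mem_block_of_support (P : Parade G K K) {I : Type*} [Finite I] {S : OrderedBigraph I}
    {F : S.toBigraph.Embedding G} (hF : P.IsOrderedRainbowCopy S F) {q : I → Fin K}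
    (hq₁ : ∀ a b : {v // v ∈ S.V₁}, S.ord₁.lt a b → q a.1 < q b.1)
    (hq₂ : ∀ a b : {v // v ∈ S.V₂}, S.ord₂.lt a b → q a.1 < q b.1)
    (hs₁ : {i | ∃ u ∈ S.V₁, q u = i} = (P.support (Set.range F.toFun)).1)
    (hs₂ : {i | ∃ u ∈ S.V₂, q u = i} = (P.support (Set.range F.toFun)).2) :
    (∀ u ∈ S.V₁, F.toFun u ∈ P.A (q u)) ∧ ∀ u ∈ S.V₂, F.toFun u ∈ P.B (q u) := by
  constructor
  · have hb : ∀ a : {v // v ∈ S.V₁}, ∃ i, F.toFun a.1 ∈ P.A i := by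
      intro a
      rcases hF.1.1 _ ⟨a.1, rfl⟩ with h | ⟨j, hj⟩
      · exact h
      · exact absurd (P.B_subset _ hj) (G.disj _ (F.map₁ _ a.2))
    choose g hg using hb
    have hgq : g = fun a => q a.1 := by
      refine eq_of_strictMono_of_range_eq S.ord₁ (fun a b hab => hF.2.1 a b hab _ _ (hg a) (hg b))
        hq₁ ?_
      ext i
      have h1 : i ∈ Set.range (fun a : {v // v ∈ S.V₁} => q a.1) ↔ i ∈ {i | ∃ u ∈ S.V₁, q u = i} := by
        simp
      rw [h1, hs₁]
      constructor
      · rintro ⟨a, rfl⟩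
        exact ⟨_, ⟨a.1, rfl⟩, hg a⟩
      · rintro ⟨_, ⟨u, rfl⟩, hu⟩
        have hu1 : u ∈ S.V₁ := (S.cover u).resolve_right fun h =>
          G.disj _ (P.A_subset _ hu) (F.map₂ _ h)
        refine ⟨⟨u, hu1⟩, ?_⟩
        by_contra hne
        exact disjoint_left.1 (P.A_disjoint _ _ hne) (hg ⟨u, hu1⟩) hu
    intro u hu
    have := hg ⟨u, hu⟩
    rwa [hgq] at this
  · have hb : ∀ a : {v // v ∈ S.V₂}, ∃ i, F.toFun a.1 ∈ P.B i := by
      intro a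
      rcases hF.1.1 _ ⟨a.1, rfl⟩ with ⟨j, hj⟩ | h
      · exact absurd (F.map₂ _ a.2) (G.disj _ (P.A_subset _ hj))
      · exact h
    choose g hg using hb
    have hgq : g = fun a => q a.1 := by
      refine eq_of_strictMono_of_range_eq S.ord₂ (fun a b hab => hF.2.2 a b hab _ _ (hg a) (hg b))
        hq₂ ?_
      ext i
      have h1 : i ∈ Set.range (fun a : {v // v ∈ S.V₂} => q a.1) ↔ i ∈ {i | ∃ u ∈ S.V₂, q u = i} := by
        simp
      rw [h1, hs₂]
      constructor
      · rintro ⟨a, rfl⟩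
        exact ⟨_, ⟨a.1, rfl⟩, hg a⟩
      · rintro ⟨_, ⟨u, rfl⟩, hu⟩
        have hu1 : u ∈ S.V₂ := (S.cover u).resolve_left fun h =>
          G.disj _ (F.map₁ _ h) (P.B_subset _ hu)
        refine ⟨⟨u, hu1⟩, ?_⟩
        by_contra hne
        exact disjoint_left.1 (P.B_disjoint _ _ hne) (hg ⟨u, hu1⟩) hu
    intro u hu
    have := hg ⟨u, hu⟩
    rwa [hgq] at this

/-- One copy makes the trace nonempty, hence full by uniformity; by invariance the contraction has
the same trace, which contains the support of `pos'`. A copy with this support has each vertex in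
its prescribed block, since the order leaves only one way to distribute the vertices. -/
theorem transfers (P : Parade G K K) {U : Type*} [Fintype U] [DecidableEq U] (T : Bigraph U)
    (S : Host V) (hSH : S.H = G.graph) (hSA : S.A = blocks P.A) (hSB : S.B = blocks P.B)
    (hSK : S.K = K) (hunif : P.IsSupportUniform S.τ) (hinv : P.IsSupportInvariant S.κ S.τ) :
    Transfers T S := by
  classical
  subst hSK
  intro D hD hDτ pos φ hpos hφ pos' hpos' hmono₁ hmono₂ X Y hX hY
  have hA : ∀ i, (#(P.A i) : ℝ) = S.W := fun i => by
    rw [← S.card_A i i.2, hSA, blocks_of_lt _ i.2]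
  have hB : ∀ i, (#(P.B i) : ℝ) = S.W := fun i => by
    rw [← S.card_B i i.2, hSB, blocks_of_lt _ i.2]
  let g : Fin #D ≃ {u // u ∈ D} := D.equivFin.symm
  let f : Fin #D → U := fun a => (g a).1
  have hfD : ∀ a, f a ∈ D := fun a => (g a).2
  have hfinj : Function.Injective f := fun a b h => g.injective (Subtype.ext h)
  -- Uniformity and invariance quantify over vertex sets in `Type`, so the part on `D` is moved to
  -- `Fin #D`.
  let S₀ : OrderedBigraph (Fin #D) := orderedPart T f (fun a => pos (f a))
    (fun a b ha hb h => hfinj (hpos.inj₁ _ (hfD a) ha _ (hfD b) hb h))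
    (fun a b ha hb h => hfinj (hpos.inj₂ _ (hfD a) ha _ (hfD b) hb h))
  have hS₁ : ∀ a, a ∈ S₀.V₁ ↔ f a ∈ T.V₁ := fun a => by simp [S₀, orderedPart]
  have hS₂ : ∀ a, a ∈ S₀.V₂ ↔ f a ∈ T.V₂ := fun a => by simp [S₀, orderedPart]
  have hlt₁ : ∀ a b : {v // v ∈ S₀.V₁}, S₀.ord₁.lt a b ↔ pos (f a.1) < pos (f b.1) :=
    fun a b => Iff.rfl
  have hlt₂ : ∀ a b : {v // v ∈ S₀.V₂}, S₀.ord₂.lt a b ↔ pos (f a.1) < pos (f b.1) :=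
    fun a b => Iff.rfl
  have hadj : ∀ a b, S₀.graph.Adj a b ↔ T.graph.Adj (f a) (f b) := fun a b => Iff.rfl
  have htree : S₀.toBigraph.IsTree := by
    let i : S₀.graph ≃g T.graph.induce (D : Set U) := ⟨g, Iff.rfl⟩
    exact i.isTree_iff.2 hD
  have hcard : Fintype.card (Fin #D) ≤ S.τ := by simpa using hDτ
  let q : Fin #D → Fin S.K := fun a => ⟨pos (f a), hpos.lt _ (hfD a)⟩
  let q' : Fin #D → Fin S.K := fun a => ⟨pos' (f a), hpos'.lt _ (hfD a)⟩
  obtain ⟨F, hFφ, hFr⟩ := P.exists_embedding S₀.toBigraph (fun a => φ (f a)) q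
    (fun a ha => by
      have := hφ.mem₁ _ (hfD a) ((hS₁ a).1 ha)
      rwa [hSA, blocks_of_lt _ (hpos.lt _ (hfD a))] at this)
    (fun a ha => by
      have := hφ.mem₂ _ (hfD a) ((hS₂ a).1 ha)
      rwa [hSB, blocks_of_lt _ (hpos.lt _ (hfD a))] at this)
    (fun a ha b hb h => hfinj (hpos.inj₁ _ (hfD a) ((hS₁ a).1 ha) _ (hfD b) ((hS₁ b).1 hb)
      (Fin.mk.inj h)))
    (fun a ha b hb h => hfinj (hpos.inj₂ _ (hfD a) ((hS₂ a).1 ha) _ (hfD b) ((hS₂ b).1 hb)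
      (Fin.mk.inj h)))
    (fun a ha b hb => by
      rw [hadj, ← hSH]
      exact hφ.adj _ (hfD a) ((hS₁ a).1 ha) _ (hfD b) ((hS₂ b).1 hb))
  have hF : P.IsOrderedRainbowCopy S₀ F := by
    refine ⟨hFr, ?_, ?_⟩
    · intro a b hab i i' hi hi'
      have ha := hφ.mem₁ _ (hfD a.1) ((hS₁ a.1).1 a.2)
      have hb := hφ.mem₁ _ (hfD b.1) ((hS₁ b.1).1 b.2)
      rw [hSA, blocks_of_lt _ (hpos.lt _ (hfD _))] at ha hb
      rw [hFφ] at hi hi'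
      have h1 : i = q a.1 := by
        by_contra hne; exact disjoint_left.1 (P.A_disjoint _ _ hne) hi ha
      have h2 : i' = q b.1 := by
        by_contra hne; exact disjoint_left.1 (P.A_disjoint _ _ hne) hi' hb
      rw [h1, h2]
      exact (hlt₁ a b).1 hab
    · intro a b hab i i' hi hi'
      have ha := hφ.mem₂ _ (hfD a.1) ((hS₂ a.1).1 a.2)
      have hb := hφ.mem₂ _ (hfD b.1) ((hS₂ b.1).1 b.2)
      rw [hSB, blocks_of_lt _ (hpos.lt _ (hfD _))] at ha hb
      rw [hFφ] at hi hi'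
      have h1 : i = q a.1 := by
        by_contra hne; exact disjoint_left.1 (P.B_disjoint _ _ hne) hi ha
      have h2 : i' = q b.1 := by
        by_contra hne; exact disjoint_left.1 (P.B_disjoint _ _ hne) hi' hb
      rw [h1, h2]
      exact (hlt₂ a b).1 hab
  have htrace : P.trace S₀ = {s | s.1.ncard = S₀.V₁.card ∧ s.2.ncard = S₀.V₂.card} := by
    rcases hunif (Fin #D) S₀ htree hcard with h | h
    · have hm : P.support (Set.range F.toFun) ∈ P.trace S₀ := ⟨F, hF, rfl⟩
      rw [h] at hm
      exact absurd hm (Set.notMem_empty _)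
    · exact h
  obtain ⟨P', hP', hPA, hPB, hPX, hPY⟩ := P.exists_subparade (mul_pos S.kappa_pos S.W_pos) hA hB
    (hSA ▸ hX) (hSB ▸ hY)
  have hmem : (({i | ∃ u ∈ S₀.V₁, q' u = i}, {i | ∃ u ∈ S₀.V₂, q' u = i}) :
      Set (Fin S.K) × Set (Fin S.K)) ∈ P'.trace S₀ := by
    rw [← hinv P' hP' hPA hPB (Fin #D) S₀ htree hcard, htrace]
    constructor
    · have : {i | ∃ u ∈ S₀.V₁, q' u = i} = q' '' (S₀.V₁ : Set (Fin #D)) := by ext; simp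
      rw [this, Set.InjOn.ncard_image, Set.ncard_coe_finset]
      intro a ha b hb h
      exact hfinj (hpos'.inj₁ _ (hfD a) ((hS₁ a).1 ha) _ (hfD b) ((hS₁ b).1 hb) (Fin.mk.inj h))
    · have : {i | ∃ u ∈ S₀.V₂, q' u = i} = q' '' (S₀.V₂ : Set (Fin #D)) := by ext; simp
      rw [this, Set.InjOn.ncard_image, Set.ncard_coe_finset]
      intro a ha b hb h
      exact hfinj (hpos'.inj₂ _ (hfD a) ((hS₂ a).1 ha) _ (hfD b) ((hS₂ b).1 hb) (Fin.mk.inj h))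
  obtain ⟨F', hF', hsupp⟩ := hmem
  obtain ⟨hs₁, hs₂⟩ := Prod.ext_iff.1 hsupp
  obtain ⟨hm₁, hm₂⟩ := P'.mem_block_of_support hF' (q := q')
    (fun a b hab => hmono₁ _ (hfD _) ((hS₁ _).1 a.2) _ (hfD _) ((hS₁ _).1 b.2) ((hlt₁ a b).1 hab))
    (fun a b hab => hmono₂ _ (hfD _) ((hS₂ _).1 a.2) _ (hfD _) ((hS₂ _).1 b.2) ((hlt₂ a b).1 hab))
    hs₁ hs₂
  have hgf : ∀ u (hu : u ∈ D), f (g.symm ⟨u, hu⟩) = u := by intro u hu; simp [f]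
  have : Nonempty V := ⟨(P.A_nonempty ⟨0, by have := S.one_lt_K; omega⟩).choose⟩
  refine ⟨fun u => if hu : u ∈ D then F'.toFun (g.symm ⟨u, hu⟩) else Classical.arbitrary V,
    ?_, ?_, ?_⟩
  · intro u hu hu1
    have h1 := hPX _ (hm₁ (g.symm ⟨u, hu⟩) ((hS₁ _).2 (by rwa [hgf u hu])))
    simpa only [q', hgf u hu, dif_pos hu] using h1
  · intro u hu hu1
    have h1 := hPY _ (hm₂ (g.symm ⟨u, hu⟩) ((hS₂ _).2 (by rwa [hgf u hu])))
    simpa only [q', hgf u hu, dif_pos hu] using h1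
  · intro u hu _ v hv _
    simp only [dif_pos hu, dif_pos hv]
    rw [hSH, F'.toFun.map_adj_iff, hadj, hgf u hu, hgf v hv]

/-- A realization of the whole of `T` is a rainbow copy. -/
theorem hasRainbowCopy_of_realized (P : Parade G K K) {U : Type*} [Fintype U] [DecidableEq U]
    {T : Bigraph U} {S : Host V} (hSH : S.H = G.graph) (hSA : S.A = blocks P.A)
    (hSB : S.B = blocks P.B) (hSK : S.K = K) {e r} (h : Realized T S e univ r) :
    P.HasRainbowCopy T := by
  subst hSK
  obtain ⟨pos, φ, hpos, hφ, -⟩ := h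
  obtain ⟨F, -, hF⟩ := P.exists_embedding T φ (fun u => ⟨pos u, hpos.lt u (mem_univ u)⟩)
    (fun u hu => by
      have := hφ.mem₁ u (mem_univ u) hu
      rwa [hSA, blocks_of_lt _ (hpos.lt u (mem_univ u))] at this)
    (fun u hu => by
      have := hφ.mem₂ u (mem_univ u) hu
      rwa [hSB, blocks_of_lt _ (hpos.lt u (mem_univ u))] at this)
    (fun u hu v hv h => hpos.inj₁ u (mem_univ u) hu v (mem_univ v) hv (Fin.mk.inj h))
    (fun u hu v hv h => hpos.inj₂ u (mem_univ u) hu v (mem_univ v) hv (Fin.mk.inj h))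
    (fun u hu v hv => by rw [← hSH]; exact hφ.adj u (mem_univ u) hu v (mem_univ v) hv)
  exact ⟨F, hF⟩

end Parade

omit [Fintype V] [DecidableEq V] in
/-- A tree without vertices on its first side is a single vertex. -/
theorem Parade.hasRainbowCopy_of_V₁_eq_empty (P : Parade G K K) (hK : 0 < K) {U : Type*}
    {T : Bigraph U} (hT : T.IsTree) (h : T.V₁ = ∅) : P.HasRainbowCopy T := by
  have h2 : ∀ u, u ∈ T.V₂ := fun u => (T.cover u).resolve_left (by simp [h])
  have huniq : ∀ u v : U, u = v := by
    intro u v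
    by_contra hne
    obtain ⟨w, hw, -⟩ := exists_adj_dist_lt hT.connected hne
    exact T.not_adj₂ (h2 u) (h2 w) hw
  obtain ⟨F, -, hF⟩ := P.exists_embedding T (fun _ => (P.B_nonempty ⟨0, hK⟩).choose)
    (fun _ => ⟨0, hK⟩) (by simp [h]) (fun _ _ => (P.B_nonempty ⟨0, hK⟩).choose_spec)
    (by simp [h]) (fun u _ v _ _ => huniq u v) (by simp [h])
  exact ⟨F, hF⟩

end Parades

theorem mainTheorem4 {U V : Type*} [Fintype U] [Fintype V]
    (δ η : ℕ) (hδ : 2 ≤ δ)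
    (T : Bigraph U) (root : U) (hT : T.IsTree)
    (hdeg : ∀ u, T.degree u ≤ δ + 1) (hroot : T.degree root ≤ δ)
    (hpath : ∀ u, T.IsLeaf u → ∀ p : T.graph.Walk root u, p.IsPath → p.length < η)
    (τ : ℕ) (hτ : τ = δ ^ (η + 1))
    (lam : ℝ) (hlam : 0 < lam) (hlam' : lam ≤ 1 / (2 ^ (30 * δ) * (δ : ℝ) ^ (1 + η)))
    (G : Bigraph V) (hG : G.IsBalanced)
    (K : ℕ) (hK : K = (32 * δ + 4) * τ + 2)
    (P : Parade G K K) (hP : P.IsBalanced)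
    (hconc : P.IsConcave lam)
    (hinv : P.IsSupportInvariant (1 / 2 ^ (30 * δ)) τ)
    (hunif : P.IsSupportUniform τ)
    (W : ℕ) (hW : P.HasWidth W W)
    (ε : ℝ) (hε : G.IsCoherent ε)
    (hεW : ε ≤ (1 / 2 ^ (30 * δ)) * ((W : ℝ) / (G.V₁.card : ℝ))) :
    P.HasRainbowCopy T := by
  classical
  -- Marks must lie in `V₁`, and any vertex there will do; the given root serves only to bound the
  -- size of `T`.
  obtain h1 | ⟨r, hr⟩ := T.V₁.eq_empty_or_nonempty
  · exact P.hasRainbowCopy_of_V₁_eq_empty (by omega) hT h1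
  have hK1 : 1 < K := by omega
  have hδτ : δ ≤ τ := by rw [hτ]; exact Nat.le_self_pow (by omega) δ
  have hA0 : (P.A ⟨0, by omega⟩).Nonempty := P.A_nonempty _
  have hWpos : (0 : ℝ) < W := by
    rw [← hW.1 ⟨0, by omega⟩]; exact_mod_cast card_pos.2 hA0
  have hV₁ : (0 : ℝ) < #G.V₁ := by
    exact_mod_cast card_pos.2 (hA0.mono (P.A_subset _))
  have hδ0 : (0 : ℝ) < (δ : ℝ) ^ (1 + η) := by positivity
  have hτlam : (τ : ℝ) * lam ≤ 1 / 2 ^ (30 * δ) := by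
    have h1 : (τ : ℝ) = (δ : ℝ) ^ (1 + η) := by rw [hτ, add_comm]; push_cast; rfl
    calc (τ : ℝ) * lam ≤ (δ : ℝ) ^ (1 + η) * (1 / (2 ^ (30 * δ) * (δ : ℝ) ^ (1 + η))) := by
          rw [h1]; gcongr
      _ = 1 / 2 ^ (30 * δ) := by field_simp
  have hδlam : (δ : ℝ) * lam ≤ 1 / 2 ^ (30 * δ) :=
    le_trans (by gcongr) hτlam
  have hδ2 : (2 : ℝ) ≤ δ := by exact_mod_cast hδ
  have hlamκ : lam ≤ 1 / 2 ^ (30 * δ) := by nlinarith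
  have hpow : ∀ n ≤ 30 * δ, (1 : ℝ) / 2 ^ (30 * δ) ≤ 1 / 2 ^ n := fun n hn =>
    one_div_le_one_div_of_le (by positivity) (pow_le_pow_right₀ (by norm_num) hn)
  have hεV : ε * #G.V₁ ≤ 1 / 2 ^ (30 * δ) * W := by
    calc ε * #G.V₁ ≤ (1 / 2 ^ (30 * δ)) * ((W : ℝ) / #G.V₁) * #G.V₁ := by gcongr
      _ = _ := by field_simp
  let S := P.toHost hG hK1 hWpos hlam hlamκ hτlam (hpow 14 (by omega))
    (fun i => by rw [hW.1 i]) (fun i => by rw [hW.2 i]) hε hεV hconc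
  have hcard : Fintype.card U ≤ S.τ :=
    (card_le_of_degree hT hδ hdeg hroot hpath).trans hτ.ge
  have hKτ : 8 * δ + τ + 4 ≤ K := by
    rw [hK]
    nlinarith
  -- With `κ = 1 / 2 ^ (30 * δ)`, the requirement `20 * δ + 14 ≤ 30 * δ` holds because `δ ≥ 2`.
  obtain ⟨e, he⟩ := exists_realized_univ (δ := δ) hT (P.transfers T S rfl rfl rfl rfl hunif hinv)
    hcard hKτ hdeg (hpow _ (by omega)) (by
      have := hpow 14 (by omega)
      change (4 * (δ : ℝ) + 1) * lam ≤ 1 / 4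
      linarith) hr
  exact P.hasRainbowCopy_of_realized rfl rfl rfl rfl he
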